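/- **Theorem (oracle posterior concentration rate for the hierarchical sieve prior).** *Data and notation.* Let $\theta^\circ=(\theta^\circ_j)_{j\ge1}$ and $\theta^\times=(\theta^\times_j)_{j\ge1}$ be square summable real sequences, $\lambda=(\lambda_j)_{j\ge1}$ a sequence of nonzero reals, and $\varsigma=(\varsigma_j)_{j\ge1}$ a real sequence. Put $$\Lambda_j=\lambda_j^{-2},\qquad \Lambda_{(m)}=\max_{1\le j\le m}\Lambda_j,\qquad \overline\Lambda_m=\frac1m\sum_{j=1}^m\Lambda_j,\qquad \mathfrak b_m=\sum_{j>m}(\theta^\circ_j-\theta^\times_j)^2 ,$$ and, for $0<\varepsilon<1$, $$G_\varepsilon=\max\{1\le m\le\lfloor\varepsilon^{-1}\rfloor:\ \varepsilon\Lambda_{(m)}\le\Lambda_1\},\qquad R^m_\varepsilon=\mathfrak b_m\vee \varepsilon m\overline\Lambda_m .$$ Let the oracle dimension $m^\circ_\varepsilon$ be the smallest minimizer of $m\mapsto R^m_\varepsilon$ over $m\ge1$, and let $r^\circ_\varepsilon=R^{m^\circ_\varepsilon}_\varepsilon=\min_{m\ge1}R^m_\varepsilon$ be the oracle rate. *Assumptions.*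 1. There is a finite constant $d>0$ with $\varsigma_j\ge d\,[\varepsilon^{1/2}\Lambda_j^{1/2}\vee\varepsilon\Lambda_j]$ for all $\varepsilon\in(0,1)$ and all $1\le j\le G_\varepsilon$. 2. There are finite constants $C\ge1$, $L\ge1$ such that for all integers $k,l\ge1$: $\lambda_j^2\le C\,\Lambda_{(k)}^{-1}$ for every $j>k$; $\Lambda_{(kl)}\le\Lambda_{(k)}\Lambda_{(l)}$; and $1\le\Lambda_{(k)}/\overline\Lambda_k\le L$. 3. For some $\varepsilon_\circ\in(0,1]$, $$\kappa^\circ:=\inf_{0<\varepsilon<\varepsilon_\circ}\ \frac{\mathfrak b_{m^\circ_\varepsilon}\wedge \varepsilon\, m^\circ_\varepsilon\,\overline\Lambda_{m^\circ_\varepsilon}}{r^\circ_\varepsilon}>0 .$$ 4. $(\log G_\varepsilon)/m^\circ_\varepsilon\to0$ as $\varepsilon\to0$. *Model and prior.* Given a parameter sequence $\theta$, the observation is $Y_j=\lambda_j\theta_j+\sqrt\varepsilon\,\xi_j$, $j\ge1$, with $\xi_j$ i.i.d. standard normal; $\mathbb E_{\theta^\circ}$ denotes expectation over $Y$ when $\theta=\theta^\circ$.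 For $m\ge1$ let $P_{\vartheta^m}$ be the law of a sequence with independent coordinates, $\vartheta^m_j\sim N(\theta^\times_j,\varsigma_j)$ for $j\le m$ and $\vartheta^m_j=\theta^\times_j$ for $j>m$. With $\sigma_j=(\lambda_j^2\varepsilon^{-1}+\varsigma_j^{-1})^{-1}$, let $M$ be a random dimension in $\{1,\dots,G_\varepsilon\}$ with $$P(M=m)=\frac{\exp(-3Cm/2)\prod_{j=1}^m(\varsigma_j/\sigma_j)^{1/2}}{\sum_{k=1}^{G_\varepsilon}\exp(-3Ck/2)\prod_{j=1}^k(\varsigma_j/\sigma_j)^{1/2}} .$$ The hierarchical prior is the law of $\vartheta^M$, i.e. the mixture $\sum_{m=1}^{G_\varepsilon}P(M=m)P_{\vartheta^m}$, and $P_{\vartheta^M\mid Y}$ is the resulting posterior, the regular conditional distribution of $\vartheta^M$ given $Y$. *Conclusion.* With $D^\circ=\lceil 5L/\kappa^\circ\rceil$ and $$K^\circ=10\Bigl(\bigl(1+\tfrac1d\bigr)\vee\frac{\|\theta^\times-\theta^\circ\|^2}{d^{2}}\Bigr)\,L^2\,\Bigl(8C\bigl(1+\tfrac1d\bigr)\vee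 D^\circ\Lambda_{(D^\circ)}\Bigr),$$ where $\|\cdot\|$ is the $\ell^2$ norm, $$\lim_{\varepsilon\to0}\ \mathbb E_{\theta^\circ}\,P_{\vartheta^M\mid Y}\Bigl((K^\circ)^{-1}r^\circ_\varepsilon\le\|\vartheta^M-\theta^\circ\|^2\le K^\circ r^\circ_\varepsilon\Bigr)=1 .$$ -/

import Mathlib

open MeasureTheory ProbabilityTheory Filter Topology

noncomputable section

namespace SieveGSSM

/-! Sequences indexed by `j = 1, 2, …` are functions `ℕ → ℝ`, the entry with index `j` being the
value at `j - 1`. Hence the first `m` coordinates are those in `Finset.range m`, and the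
coordinates with index `> m` are `m + i`, `i : ℕ`. Dimensions `m ≥ 1` are natural numbers and are
not shifted. -/

/-! ### The operator sequence -/

/-- The maximum of `λ_j⁻²` over the first `m` indices (for `m ≥ 1`). -/
def maxInvSq (lam : ℕ → ℝ) (m : ℕ) : ℝ := ⨆ j : Fin m, (lam j ^ 2)⁻¹

/-- The mean of `λ_j⁻²` over the first `m` indices (for `m ≥ 1`). -/
def meanInvSq (lam : ℕ → ℝ) (m : ℕ) : ℝ :=
  (m : ℝ)⁻¹ * ∑ j ∈ Finset.range m, (lam j ^ 2)⁻¹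

/-- The regularity conditions on the operator sequence, with constants `C` and `L`. -/
structure OperatorRegular (lam : ℕ → ℝ) (C L : ℝ) : Prop where
  one_le_C : 1 ≤ C
  one_le_L : 1 ≤ L
  tail_le : ∀ k : ℕ, 1 ≤ k → ∀ i : ℕ, lam (k + i) ^ 2 ≤ C * (maxInvSq lam k)⁻¹
  submul : ∀ k l : ℕ, 1 ≤ k → 1 ≤ l →
    maxInvSq lam (k * l) ≤ maxInvSq lam k * maxInvSq lam l
  max_mean : ∀ k : ℕ, 1 ≤ k →
    1 ≤ maxInvSq lam k / meanInvSq lam k ∧ maxInvSq lam k / meanInvSq lam k ≤ L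

/-- The largest dimension `G_ε`. -/
def maxDim (lam : ℕ → ℝ) (ε : ℝ) : ℕ :=
  sSup {m : ℕ | 1 ≤ m ∧ m ≤ ⌊ε⁻¹⌋₊ ∧ ε * maxInvSq lam m ≤ maxInvSq lam 1}

/-- The condition on the prior variances `v_j`, with constant `d`. -/
def PriorVarianceCondition (lam v : ℕ → ℝ) (d : ℝ) : Prop :=
  0 < d ∧ ∀ ε ∈ Set.Ioo (0 : ℝ) 1, ∀ j < maxDim lam ε,
    d * max (√ε * √((lam j ^ 2)⁻¹)) (ε * (lam j ^ 2)⁻¹) ≤ v j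

/-! ### The oracle -/

/-- The squared bias `∑_{j > m} (θ°_j - θˣ_j)²`. -/
def bias (θ₀ μ : ℕ → ℝ) (m : ℕ) : ℝ := ∑' i : ℕ, (θ₀ (m + i) - μ (m + i)) ^ 2

/-- `bias ∨ ε m (mean of λ_j⁻²)`. -/
def rate (lam θ₀ μ : ℕ → ℝ) (ε : ℝ) (m : ℕ) : ℝ :=
  max (bias θ₀ μ m) (ε * m * meanInvSq lam m)

/-- The oracle dimension: the smallest minimizer of the rate over `m ≥ 1`. -/
def oracleDim (lam θ₀ μ : ℕ → ℝ) (ε : ℝ) : ℕ :=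
  sInf {m : ℕ | 1 ≤ m ∧ ∀ k : ℕ, 1 ≤ k → rate lam θ₀ μ ε m ≤ rate lam θ₀ μ ε k}

/-- The oracle rate. -/
def oracleRate (lam θ₀ μ : ℕ → ℝ) (ε : ℝ) : ℝ :=
  rate lam θ₀ μ ε (oracleDim lam θ₀ μ ε)

/-- `κ°`: the infimum over `0 < ε < ε₀` of `bias ∧ ε m (mean of λ_j⁻²)`, taken at the oracle
dimension and divided by the oracle rate. -/
def oracleKappa (lam θ₀ μ : ℕ → ℝ) (ε₀ : ℝ) : ℝ :=
  sInf ((fun ε : ℝ => (oracleRate lam θ₀ μ ε)⁻¹ *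
    min (bias θ₀ μ (oracleDim lam θ₀ μ ε))
      (ε * (oracleDim lam θ₀ μ ε : ℝ) * meanInvSq lam (oracleDim lam θ₀ μ ε))) ''
    Set.Ioo 0 ε₀)

/-- `D° = ⌈5 L / κ°⌉`. -/
def oracleD (lam θ₀ μ : ℕ → ℝ) (L ε₀ : ℝ) : ℕ := ⌈5 * L / oracleKappa lam θ₀ μ ε₀⌉₊

/-- The constant `K°`. -/
def oracleConst (lam θ₀ μ : ℕ → ℝ) (d C L ε₀ : ℝ) : ℝ :=
  10 * max (1 + 1 / d) ((∑' j : ℕ, (θ₀ j - μ j) ^ 2) / d ^ 2) * L ^ 2 *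
    max (8 * C * (1 + 1 / d))
      ((oracleD lam θ₀ μ L ε₀ : ℝ) * maxInvSq lam (oracleD lam θ₀ μ L ε₀))

/-! ### The observation model -/

/-- The law of `Y = (λ_j θ_j + √ε ξ_j)_j` with `ξ_j` i.i.d. standard normal. -/
def obsLaw (lam : ℕ → ℝ) (ε : ℝ) (θ : ℕ → ℝ) : Measure (ℕ → ℝ) :=
  (Measure.infinitePi fun _ : ℕ => gaussianReal 0 1).map
    fun ξ j => lam j * θ j + √ε * ξ j

theorem measurable_obsMap (lam : ℕ → ℝ) (ε : ℝ) :
    Measurable fun p : (ℕ → ℝ) × (ℕ → ℝ) => fun j => lam j * p.1 j + √ε * p.2 j := by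
  fun_prop

theorem measurable_obsMap_right (lam : ℕ → ℝ) (ε : ℝ) (θ : ℕ → ℝ) :
    Measurable fun ξ : ℕ → ℝ => fun j => lam j * θ j + √ε * ξ j :=
  (measurable_obsMap lam ε).comp measurable_prodMk_left

instance (lam : ℕ → ℝ) (ε : ℝ) (θ : ℕ → ℝ) : IsProbabilityMeasure (obsLaw lam ε θ) :=
  Measure.isProbabilityMeasure_map (measurable_obsMap_right lam ε θ).aemeasurable

theorem measurable_obsLaw (lam : ℕ → ℝ) (ε : ℝ) : Measurable (obsLaw lam ε) := by
  refine Measure.measurable_of_measurable_coe _ fun s hs => ?_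
  have h := measurable_measure_prodMk_left
    (ν := Measure.infinitePi fun _ : ℕ => gaussianReal 0 1) (measurable_obsMap lam ε hs)
  convert h using 2 with θ
  rw [obsLaw, Measure.map_apply (measurable_obsMap_right lam ε θ) hs]
  rfl

/-- The statistical model as a Markov kernel from parameters to observations. -/
def obsKernel (lam : ℕ → ℝ) (ε : ℝ) : Kernel (ℕ → ℝ) (ℕ → ℝ) :=
  ⟨obsLaw lam ε, measurable_obsLaw lam ε⟩

instance (lam : ℕ → ℝ) (ε : ℝ) : IsMarkovKernel (obsKernel lam ε) :=
  ⟨fun θ => inferInstanceAs (IsProbabilityMeasure (obsLaw lam ε θ))⟩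

/-! ### The hierarchical sieve prior and its posterior -/

/-- The sieve prior of dimension `m`: independent coordinates, `N(μ_j, v_j)` for the first `m`
coordinates and the point mass at `μ_j` (the Gaussian of variance `0`) for the others. -/
def sievePrior (μ v : ℕ → ℝ) (m : ℕ) : Measure (ℕ → ℝ) :=
  Measure.infinitePi fun j : ℕ => gaussianReal (μ j) (if j < m then (v j).toNNReal else 0)

instance (μ v : ℕ → ℝ) (m : ℕ) : IsProbabilityMeasure (sievePrior μ v m) :=
  inferInstanceAs (IsProbabilityMeasure (Measure.infinitePi _))

/-- `σ_j = (λ_j² / ε + 1 / v_j)⁻¹`. -/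
def postVar (lam v : ℕ → ℝ) (ε : ℝ) (j : ℕ) : ℝ := (lam j ^ 2 * ε⁻¹ + (v j)⁻¹)⁻¹

/-- The unnormalized prior weight of dimension `m`. -/
def dimWeight (lam v : ℕ → ℝ) (C ε : ℝ) (m : ℕ) : ℝ :=
  Real.exp (-3 * C * m / 2) * ∏ j ∈ Finset.range m, √(v j / postVar lam v ε j)

/-- The prior probability that the random dimension equals `m`, for `1 ≤ m ≤ G_ε`. -/
def dimPrior (lam v : ℕ → ℝ) (C ε : ℝ) (m : ℕ) : ℝ :=
  dimWeight lam v C ε m / ∑ k ∈ Finset.Icc 1 (maxDim lam ε), dimWeight lam v C ε k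

/-- The hierarchical prior: draw the dimension `m` in `{1, …, G_ε}` from `dimPrior`, then draw the
parameter sequence from the sieve prior of dimension `m`. -/
def hierPrior (lam μ v : ℕ → ℝ) (C ε : ℝ) : Measure (ℕ → ℝ) :=
  ∑ m ∈ Finset.Icc 1 (maxDim lam ε), ENNReal.ofReal (dimPrior lam v C ε m) • sievePrior μ v m

instance (lam μ v : ℕ → ℝ) (C ε : ℝ) : IsFiniteMeasure (hierPrior lam μ v C ε) := by
  constructor
  simp [hierPrior, Measure.finsetSum_apply, ENNReal.sum_lt_top]

/-- The posterior: the regular conditional distribution of the parameter sequence given the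
observation, when the parameter sequence is drawn from the hierarchical prior. -/
def hierPosterior (lam μ v : ℕ → ℝ) (C ε : ℝ) : Kernel (ℕ → ℝ) (ℕ → ℝ) :=
  posterior (obsKernel lam ε) (hierPrior lam μ v C ε)

/-- The squared `ℓ²`-distance, with value `∞` if the difference is not square summable. -/
def sqDist (ϑ θ₀ : ℕ → ℝ) : ENNReal := ∑' j : ℕ, ENNReal.ofReal ((ϑ j - θ₀ j) ^ 2)

end SieveGSSM

end

/-! Given the dimension, prior and model are Gaussian and split over coordinates, so the posterior
is explicit. The factor `∏ √(v j / σ_j)` in the prior weights cancels the normalizing factor of the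
marginal density of `Y`. Hence dimension `m` has posterior weight proportional to the penalized
exponential `exp(-3Cm/2 + ∑_{j<m} gain_j (Y_j - λ_j μ_j)² / (2ε))`, and the posterior is the mixture
of the sieve posteriors with these weights (`hierPosterior_apply_ae_eq`). This identity holds almost
surely under the marginal law of `Y`. It is needed under the law at `θ₀`, which is absolutely
continuous with respect to the marginal by a Cameron–Martin argument
(`gaussianSeq_absolutelyContinuous`).

Write `k` for the oracle dimension and `r` for the oracle rate. The core is
`lintegral_modelProb_mul_le`: for small `ε`, each `m ≤ G_ε` contributes at most `2 exp(A - c k)` to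
the expected posterior mass outside the shell `[r/K°, K° r]`, with `A` and `c > 0` independent of
`ε` and `m`. There are three kinds of dimension: (i) `m < k` with bias much larger than `r`: the
data show the signal missing between `m` and `k`, so dimension `m` has exponentially small posterior
probability (`lintegral_modelProb_le_of_lt`); (ii) `m > k` with `m ε Λ_(k)` much larger than `r`:
the penalty dominates the likelihood gain (`lintegral_modelProb_le_of_gt`); (iii) otherwise the bias
is `O(r)` and `m ≤ D° k`: averaging the sieve posterior over `Y` gives a product Gaussian law, and
Chernoff bounds confine the squared distance to the shell (`predictiveLaw_gt_le`,
`predictiveLaw_lt_le`).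

Summing over `m` costs a factor `G_ε`. Since `κ° > 0` forces `k → ∞` and `log G_ε = o(k)`, the total
tends to `0`. -/

noncomputable section

namespace SieveGSSM

open scoped ENNReal NNReal

/-! ### Products of Markov kernels, and densities on infinite products -/

section ProductKernels

variable {ι : Type*} {X Y : ι → Type*} [∀ i, MeasurableSpace (X i)] [∀ i, MeasurableSpace (Y i)]

theorem lintegral_prod_infinitePi (μ : ∀ i, Measure (X i)) [∀ i, IsProbabilityMeasure (μ i)]
    (s : Finset ι) {f : ∀ i, X i → ℝ≥0∞} (hf : ∀ i, Measurable (f i)) :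
    ∫⁻ x, ∏ i ∈ s, f i (x i) ∂(Measure.infinitePi μ) = ∏ i ∈ s, ∫⁻ y, f i y ∂(μ i) := by
  rw [lintegral_prod_eq_prod_lintegral_of_indepFun s (fun i (x : ∀ i, X i) => f i (x i))
    (iIndepFun_infinitePi hf) (fun i => (hf i).comp (measurable_pi_apply i))]
  refine Finset.prod_congr rfl fun i _ => ?_
  rw [← Measure.infinitePi_map_eval μ i, lintegral_map (hf i) (measurable_pi_apply i)]

/-- The product of a family of Markov kernels, acting coordinatewise. -/
def piKernel (k : ∀ i, Kernel (X i) (Y i)) [∀ i, IsMarkovKernel (k i)] :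
    Kernel (∀ i, X i) (∀ i, Y i) where
  toFun x := Measure.infinitePi fun i => k i (x i)
  measurable' := by
    refine Measurable.measure_of_isPiSystem_of_isProbabilityMeasure
      (generateFrom_squareCylinders (α := Y)).symm
      (isPiSystem_squareCylinders (fun _ => MeasurableSpace.isPiSystem_measurableSet)
        fun _ => MeasurableSet.univ) ?_
    rintro _ ⟨s, t, ht, rfl⟩
    have ht' : ∀ i, MeasurableSet (t i) := fun i => ht i (Set.mem_univ i)
    simp only [Measure.infinitePi_pi _ (fun i _ => ht' i)]
    exact Finset.measurable_prod _ fun i _ =>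
      ((k i).measurable_coe (ht' i)).comp (measurable_pi_apply i)

theorem piKernel_apply (k : ∀ i, Kernel (X i) (Y i)) [∀ i, IsMarkovKernel (k i)] (x : ∀ i, X i) :
    piKernel k x = Measure.infinitePi fun i => k i (x i) := rfl

instance (k : ∀ i, Kernel (X i) (Y i)) [∀ i, IsMarkovKernel (k i)] :
    IsMarkovKernel (piKernel k) :=
  ⟨fun x => by rw [piKernel_apply]; infer_instance⟩

theorem piKernel_comp_infinitePi (μ : ∀ i, Measure (X i)) [∀ i, IsProbabilityMeasure (μ i)]
    (k : ∀ i, Kernel (X i) (Y i)) [∀ i, IsMarkovKernel (k i)] :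
    piKernel k ∘ₘ Measure.infinitePi μ = Measure.infinitePi fun i => k i ∘ₘ μ i := by
  refine Measure.eq_infinitePi _ fun s t ht => ?_
  rw [Measure.bind_apply (.pi s.countable_toSet fun i _ => ht i) (Kernel.aemeasurable _)]
  simp only [piKernel_apply, Measure.infinitePi_pi _ (fun i _ => ht i)]
  rw [lintegral_prod_infinitePi μ s fun i => (k i).measurable_coe (ht i)]
  refine Finset.prod_congr rfl fun i _ => ?_
  rw [Measure.bind_apply (ht i) (Kernel.aemeasurable _)]

/-- Regrouping a pair of sequences as a sequence of pairs makes the joint law a product measure,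
which is determined by its values on finite boxes. Reversing a disintegration thereby becomes a
coordinatewise matter. -/
theorem infinitePi_compProd_piKernel (μ : ∀ i, Measure (X i)) [∀ i, IsProbabilityMeasure (μ i)]
    (k : ∀ i, Kernel (X i) (Y i)) [∀ i, IsMarkovKernel (k i)] :
    Measure.infinitePi μ ⊗ₘ piKernel k =
      (Measure.infinitePi fun i => μ i ⊗ₘ k i).map
        fun p => (fun i => (p i).1, fun i => (p i).2) := by
  have hz : Measurable fun (p : (∀ i, X i) × (∀ i, Y i)) i => (p.1 i, p.2 i) := by fun_prop
  have hu : Measurable fun p : ∀ i, X i × Y i => ((fun i => (p i).1, fun i => (p i).2) :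
      (∀ i, X i) × (∀ i, Y i)) := by fun_prop
  have key : (Measure.infinitePi μ ⊗ₘ piKernel k).map (fun p i => (p.1 i, p.2 i)) =
      Measure.infinitePi fun i => μ i ⊗ₘ k i := by
    refine Measure.eq_infinitePi _ fun s t ht => ?_
    have hpi : MeasurableSet (Set.pi (s : Set ι) t) := .pi s.countable_toSet fun i _ => ht i
    rw [Measure.map_apply hz hpi, Measure.compProd_apply (hz hpi)]
    have (x : ∀ i, X i) : piKernel k x (Prod.mk x ⁻¹' ((fun (p : (∀ i, X i) × (∀ i, Y i)) i =>
        (p.1 i, p.2 i)) ⁻¹' (Set.pi (s : Set ι) t))) =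
        ∏ i ∈ s, k i (x i) (Prod.mk (x i) ⁻¹' t i) := by
      rw [piKernel_apply, ← Measure.infinitePi_pi _ (fun i _ => measurable_prodMk_left (ht i))]
      rfl
    simp only [this]
    rw [lintegral_prod_infinitePi μ s (f := fun i x => k i x (Prod.mk x ⁻¹' t i))
      fun i => Kernel.measurable_kernel_prodMk_left (ht i)]
    refine Finset.prod_congr rfl fun i _ => ?_
    rw [Measure.compProd_apply (ht i)]
  rw [← key, Measure.map_map hu hz]
  exact Measure.map_id.symm

/-- If each coordinate admits a disintegration in the reverse direction, so does the product. -/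
theorem infinitePi_compProd_piKernel_swap {μ : ∀ i, Measure (X i)}
    [∀ i, IsProbabilityMeasure (μ i)] {k : ∀ i, Kernel (X i) (Y i)} [∀ i, IsMarkovKernel (k i)]
    {ν : ∀ i, Measure (Y i)} [∀ i, IsProbabilityMeasure (ν i)] {l : ∀ i, Kernel (Y i) (X i)}
    [∀ i, IsMarkovKernel (l i)] (h : ∀ i, (μ i ⊗ₘ k i).map Prod.swap = ν i ⊗ₘ l i) :
    (Measure.infinitePi μ ⊗ₘ piKernel k).map Prod.swap = Measure.infinitePi ν ⊗ₘ piKernel l := by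
  rw [infinitePi_compProd_piKernel, infinitePi_compProd_piKernel,
    Measure.map_map measurable_swap (by fun_prop)]
  simp only [← h]
  rw [← Measure.infinitePi_map_pi _ (fun i => measurable_swap),
    Measure.map_map (by fun_prop) (by fun_prop)]
  rfl

theorem infinitePi_withDensity_prod (μ ν : ∀ i, Measure (X i)) [∀ i, IsProbabilityMeasure (μ i)]
    [∀ i, IsProbabilityMeasure (ν i)] (s : Finset ι) {f : ∀ i, X i → ℝ≥0∞}
    (hf : ∀ i, Measurable (f i)) (hs : ∀ i ∈ s, ν i = (μ i).withDensity (f i))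
    (hs' : ∀ i ∉ s, ν i = μ i) :
    Measure.infinitePi ν = (Measure.infinitePi μ).withDensity fun x => ∏ i ∈ s, f i (x i) := by
  classical
  refine (Measure.eq_infinitePi _ fun u t ht => ?_).symm
  have hpi : MeasurableSet (Set.pi (u : Set ι) t) := .pi u.countable_toSet fun i _ => ht i
  rw [withDensity_apply _ hpi, ← lintegral_indicator hpi]
  have hg (x : ∀ i, X i) : (Set.pi (u : Set ι) t).indicator (fun x => ∏ i ∈ s, f i (x i)) x =
      ∏ i ∈ s ∪ u, (if i ∈ s then f i (x i) else 1) *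
        (if i ∈ u then (t i).indicator 1 (x i) else 1) := by
    rw [Finset.prod_mul_distrib, Finset.prod_ite_mem, Finset.prod_ite_mem,
      Finset.inter_eq_right.2 Finset.subset_union_left,
      Finset.inter_eq_right.2 Finset.subset_union_right]
    by_cases hx : x ∈ Set.pi (u : Set ι) t
    · rw [Set.indicator_of_mem hx, Finset.prod_eq_one (s := u), mul_one]
      intro i hi
      rw [Set.indicator_of_mem (hx i hi)]
      rfl
    · rw [Set.indicator_of_notMem hx]
      obtain ⟨i, hi, hxi⟩ : ∃ i ∈ u, x i ∉ t i := by simpa [Set.mem_pi] using hx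
      rw [Finset.prod_eq_zero hi (Set.indicator_of_notMem hxi _), mul_zero]
  simp only [hg]
  rw [lintegral_prod_infinitePi μ _ (f := fun i y => (if i ∈ s then f i y else 1) *
        (if i ∈ u then (t i).indicator 1 y else 1)) (fun i => ?_)]
  · rw [← Finset.prod_subset (s₁ := u) Finset.subset_union_right]
    · refine Finset.prod_congr rfl fun i hi => ?_
      simp only [hi, if_true]
      have h1 : ∀ y, (if i ∈ s then f i y else 1) * (t i).indicator 1 y =
          (t i).indicator (fun y => if i ∈ s then f i y else 1) y := by
        intro y
        by_cases hy : y ∈ t i <;> simp [hy]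
      simp only [h1]
      rw [lintegral_indicator (ht i)]
      by_cases his : i ∈ s
      · simp [his, hs i his, withDensity_apply _ (ht i)]
      · simp [his, hs' i his]
    -- A coordinate in `s` that the box leaves free contributes the total mass of its density, which
    -- is `1` because `ν i` is a probability measure.
    · intro i hi hiu
      have his : i ∈ s := by simpa [hiu] using hi
      have := measure_univ (μ := ν i)
      rw [hs i his, withDensity_apply _ MeasurableSet.univ, Measure.restrict_univ] at this
      simpa [his, hiu] using this
  · refine Measurable.mul ?_ ?_
    · split_ifs
      exacts [hf i, measurable_const]
    · split_ifs
      exacts [measurable_one.indicator (ht i), measurable_const]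

end ProductKernels

/-! ### One-dimensional Gaussian computations -/

section Gaussian

/-- The kernel sending `x` to the Gaussian law with mean `a * x + b` and variance `w`. -/
def linGauss (a b : ℝ) (w : ℝ≥0) : Kernel ℝ ℝ where
  toFun x := gaussianReal (a * x + b) w
  measurable' := by
    have h : Measurable fun x : ℝ => (a * x + b, w) := by fun_prop
    exact measurable_gaussianReal.comp h

theorem linGauss_apply (a b : ℝ) (w : ℝ≥0) (x : ℝ) :
    linGauss a b w x = gaussianReal (a * x + b) w := rfl

instance (a b : ℝ) (w : ℝ≥0) : IsMarkovKernel (linGauss a b w) :=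
  ⟨fun x => by rw [linGauss_apply]; infer_instance⟩

theorem linGauss_comp_gaussianReal (a b m : ℝ) (v w : ℝ≥0) :
    linGauss a b w ∘ₘ gaussianReal m v =
      gaussianReal (a * m + b) ((a ^ 2).toNNReal * v + w) := by
  have hm : (gaussianReal m v).map (fun x => a * x + b) =
      gaussianReal (a * m + b) ((a ^ 2).toNNReal * v) := by
    have h : (a ^ 2).toNNReal = .mk (a ^ 2) (sq_nonneg a) := NNReal.eq (Real.coe_toNNReal _ (sq_nonneg a))
    rw [h, ← gaussianReal_map_add_const, ← gaussianReal_map_const_mul,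
      Measure.map_map (by fun_prop) (by fun_prop)]
    rfl
  have hc := gaussianReal_conv_gaussianReal (m₁ := a * m + b) (m₂ := 0)
    (v₁ := (a ^ 2).toNNReal * v) (v₂ := w)
  rw [add_zero] at hc
  rw [← hc, ← hm]
  ext s hs
  rw [Measure.bind_apply hs (Kernel.aemeasurable _), Measure.conv, Measure.map_apply (by fun_prop) hs,
    Measure.prod_apply ((by fun_prop : Measurable fun p : ℝ × ℝ => p.1 + p.2) hs),
    lintegral_map (measurable_measure_prodMk_left
      ((by fun_prop : Measurable fun p : ℝ × ℝ => p.1 + p.2) hs)) (by fun_prop)]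
  refine lintegral_congr fun x => ?_
  rw [linGauss_apply, ← zero_add (a * x + b), ← gaussianReal_map_const_add,
    Measure.map_apply (by fun_prop) hs]
  simp only [zero_add]
  rfl

theorem gaussianPDFReal_mul_gaussianPDFReal_comm (a m x y : ℝ) {v w : ℝ≥0} (hv : v ≠ 0)
    (hw : w ≠ 0) :
    gaussianPDFReal m v x * gaussianPDFReal (a * x) w y =
      gaussianPDFReal (a * m) ((a ^ 2).toNNReal * v + w) y *
        gaussianPDFReal (a * v / (a ^ 2 * v + w) * y + (m - a * v / (a ^ 2 * v + w) * (a * m)))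
          (v * w / ((a ^ 2).toNNReal * v + w)) x := by
  have hv' : (0 : ℝ) < v := by positivity
  have hw' : (0 : ℝ) < w := by positivity
  have hs : (0 : ℝ) < a ^ 2 * v + w := by positivity
  simp only [gaussianPDFReal, NNReal.coe_add, NNReal.coe_mul, NNReal.coe_div, Real.coe_toNNReal _ (sq_nonneg a)]
  have h1 : ∀ p q A B : ℝ, (√p)⁻¹ * A * ((√q)⁻¹ * B) = (√p * √q)⁻¹ * (A * B) := by
    intros; rw [mul_inv]; ring
  rw [h1, h1, ← Real.exp_add, ← Real.exp_add, ← Real.sqrt_mul (by positivity),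
    ← Real.sqrt_mul (by positivity)]
  refine congrArg₂ (· * ·) (congrArg (fun z => (√z)⁻¹) ?_) (congrArg Real.exp ?_)
  · field_simp
  · field_simp
    ring

/-- Gaussian conjugacy. -/
theorem gaussianReal_compProd_linGauss_swap (a m : ℝ) (v : ℝ≥0) {w : ℝ≥0} (hw : w ≠ 0) :
    (gaussianReal m v ⊗ₘ linGauss a 0 w).map Prod.swap =
      gaussianReal (a * m) ((a ^ 2).toNNReal * v + w) ⊗ₘ
        linGauss (a * v / (a ^ 2 * v + w)) (m - a * v / (a ^ 2 * v + w) * (a * m))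
          (v * w / ((a ^ 2).toNNReal * v + w)) := by
  refine Measure.ext_prod fun {s t} hs ht => ?_
  rw [Measure.map_apply measurable_swap (hs.prod ht), Set.preimage_swap_prod,
    Measure.compProd_apply_prod ht hs, Measure.compProd_apply_prod hs ht]
  simp only [linGauss_apply, add_zero]
  -- Degenerate priors must be covered: beyond the sieve dimension the prior coordinate is a point
  -- mass, which has no Lebesgue density.
  by_cases hv : v = 0
  · subst hv
    simp only [gaussianReal_zero_var, NNReal.coe_zero, mul_zero, zero_div, zero_mul, sub_zero,
      zero_add, setLIntegral_const]
    classical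
    rw [setLIntegral_dirac' (f := fun x => gaussianReal (a * x) w s) ?_ ht]
    · by_cases hm : m ∈ t <;> simp [hm, ht]
    · have : Measurable fun x : ℝ => linGauss a 0 w x s := Kernel.measurable_coe _ hs
      simpa [linGauss_apply] using this
  · have hS : ((a ^ 2).toNNReal * v + w : ℝ≥0) ≠ 0 := by positivity
    have hT : v * w / ((a ^ 2).toNNReal * v + w : ℝ≥0) ≠ 0 := by positivity
    have hmeas (b c : ℝ) (u : ℝ≥0) {s : Set ℝ} (hs : MeasurableSet s) :
        Measurable fun x : ℝ => gaussianReal (b * x + c) u s :=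
      Kernel.measurable_coe (linGauss b c u) hs
    have hmeas0 : Measurable fun x : ℝ => gaussianReal (a * x) w s := by
      simpa using hmeas a 0 w hs
    rw [gaussianReal_of_var_ne_zero m hv, gaussianReal_of_var_ne_zero (a * m) hS,
      setLIntegral_withDensity_eq_setLIntegral_mul _ (measurable_gaussianPDF _ _) hmeas0 ht,
      setLIntegral_withDensity_eq_setLIntegral_mul _ (measurable_gaussianPDF _ _)
        (hmeas _ _ _ ht) hs]
    simp only [Pi.mul_apply, gaussianReal_apply _ hw, gaussianReal_apply _ hT]
    simp_rw [← lintegral_const_mul _ (measurable_gaussianPDF _ _)]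
    simp only [gaussianPDF, ← ENNReal.ofReal_mul (gaussianPDFReal_nonneg _ _ _)]
    rw [lintegral_lintegral_swap]
    · refine lintegral_congr fun y => lintegral_congr fun x => ?_
      rw [gaussianPDFReal_mul_gaussianPDFReal_comm a m x y hv hw]
    · have hp : Measurable fun p : ℝ × ℝ => gaussianPDFReal (a * p.1) w p.2 :=
        measurable_uncurry_gaussianPDFReal.comp
          (by fun_prop : Measurable fun p : ℝ × ℝ => (a * p.1, w, p.2))
      exact (ENNReal.measurable_ofReal.comp
        (((measurable_gaussianPDFReal m v).comp measurable_fst).mul hp)).aemeasurable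

/-- Completing the square. Integrating gives the Laplace transform of a noncentral squared Gaussian,
the source of every exponential bound below. -/
theorem exp_sq_mul_gaussianPDFReal (m c t x : ℝ) {v : ℝ≥0} (hv : v ≠ 0) (ht : 2 * t * v < 1) :
    Real.exp (t * (x - c) ^ 2) * gaussianPDFReal m v x =
      (√(1 - 2 * t * v))⁻¹ * Real.exp (t * (m - c) ^ 2 / (1 - 2 * t * v)) *
        gaussianPDFReal ((m - 2 * t * v * c) / (1 - 2 * t * v))
          (v / (1 - 2 * t * v).toNNReal) x := by
  have hv' : (0 : ℝ) < v := by positivity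
  have h1 : 0 < 1 - 2 * t * v := by linarith
  simp only [gaussianPDFReal, NNReal.coe_div, Real.coe_toNNReal _ h1.le]
  obtain ⟨D, hD⟩ : ∃ D, D = 1 - 2 * t * v := ⟨_, rfl⟩
  have htD : t = (1 - D) / (2 * v) := by rw [hD]; field_simp; ring
  have h3 : 2 * t * v = 1 - D := by rw [hD]; ring
  rw [← hD] at h1
  rw [h3, htD, sub_sub_cancel]
  have h2 : ∀ p q A B : ℝ, (√q)⁻¹ * A * ((√p)⁻¹ * B) = (√q * √p)⁻¹ * (A * B) := by
    intros; rw [mul_inv]; ring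
  rw [h2, ← Real.exp_add, ← Real.sqrt_mul h1.le, mul_left_comm (Real.exp _), ← Real.exp_add]
  refine congrArg₂ (· * ·) (congrArg (fun z => (√z)⁻¹) ?_) (congrArg Real.exp ?_)
  · field_simp
  · field_simp
    ring

theorem lintegral_exp_sq_gaussianReal (m c t : ℝ) {v : ℝ≥0} (hv : v ≠ 0) (ht : 2 * t * v < 1) :
    ∫⁻ x, ENNReal.ofReal (Real.exp (t * (x - c) ^ 2)) ∂(gaussianReal m v) =
      ENNReal.ofReal ((√(1 - 2 * t * v))⁻¹ * Real.exp (t * (m - c) ^ 2 / (1 - 2 * t * v))) := by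
  have h1 : 0 < 1 - 2 * t * v := by linarith
  have hv' : v / (1 - 2 * t * v).toNNReal ≠ 0 := by
    have : 0 < (1 - 2 * t * v).toNNReal := Real.toNNReal_pos.2 h1
    positivity
  rw [gaussianReal_of_var_ne_zero m hv,
    lintegral_withDensity_eq_lintegral_mul _ (measurable_gaussianPDF _ _) (by fun_prop)]
  simp only [Pi.mul_apply, gaussianPDF, ← ENNReal.ofReal_mul (gaussianPDFReal_nonneg _ _ _)]
  simp only [mul_comm (gaussianPDFReal _ _ _), exp_sq_mul_gaussianPDFReal m c t _ hv ht]
  have h2 : 0 ≤ (√(1 - 2 * t * v))⁻¹ * Real.exp (t * (m - c) ^ 2 / (1 - 2 * t * v)) := by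
    positivity
  simp only [ENNReal.ofReal_mul h2]
  rw [lintegral_const_mul _ (by fun_prop), lintegral_gaussianPDFReal_eq_one _ hv', mul_one]

theorem gaussianReal_eq_withDensity_of_var (m : ℝ) {v w : ℝ≥0} (hv : v ≠ 0) (hw : w ≠ 0) :
    gaussianReal m w = (gaussianReal m v).withDensity fun x =>
      ENNReal.ofReal (√(v / w) * Real.exp ((1 / v - 1 / w) / 2 * (x - m) ^ 2)) := by
  have hv' : (0 : ℝ) < v := by positivity
  have hw' : (0 : ℝ) < w := by positivity
  rw [gaussianReal_of_var_ne_zero m hv, gaussianReal_of_var_ne_zero m hw,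
    ← withDensity_mul _ (measurable_gaussianPDF _ _) (by fun_prop)]
  congr 1 with x
  rw [Pi.mul_apply, gaussianPDF, gaussianPDF, ← ENNReal.ofReal_mul (gaussianPDFReal_nonneg _ _ _)]
  congr 1
  simp only [gaussianPDFReal]
  have h2 : ∀ p q A B : ℝ, (√q)⁻¹ * A * (√p * B) = ((√q)⁻¹ * √p) * (A * B) := by
    intros; ring
  rw [h2, ← Real.exp_add, ← Real.sqrt_inv, ← Real.sqrt_inv, ← Real.sqrt_mul (by positivity)]
  refine congrArg₂ (· * ·) (congrArg _ ?_) (congrArg Real.exp ?_)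
  · field_simp
  · field_simp
    ring

theorem gaussianReal_eq_withDensity_of_mean (m m' : ℝ) {v : ℝ≥0} (hv : v ≠ 0) :
    gaussianReal m' v = (gaussianReal m v).withDensity fun x =>
      ENNReal.ofReal (Real.exp (((m' - m) * (x - m) - (m' - m) ^ 2 / 2) / v)) := by
  have hv' : (0 : ℝ) < v := by positivity
  rw [gaussianReal_of_var_ne_zero m hv, gaussianReal_of_var_ne_zero m' hv,
    ← withDensity_mul _ (measurable_gaussianPDF _ _) (by fun_prop)]
  congr 1 with x
  rw [Pi.mul_apply, gaussianPDF, gaussianPDF, ← ENNReal.ofReal_mul (gaussianPDFReal_nonneg _ _ _)]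
  congr 1
  simp only [gaussianPDFReal]
  rw [mul_assoc _ (Real.exp _), ← Real.exp_add]
  congr 2
  field_simp
  ring

theorem lintegral_exp_linear_gaussianReal (m m' : ℝ) {v : ℝ≥0} (hv : v ≠ 0) :
    ∫⁻ x, ENNReal.ofReal (Real.exp (((m' - m) * (x - m) - (m' - m) ^ 2 / 2) / v)) ^ 2
      ∂(gaussianReal m v) = ENNReal.ofReal (Real.exp ((m' - m) ^ 2 / v)) := by
  have hv' : (0 : ℝ) < v := by positivity
  -- The square of the likelihood ratio for the shift `m' - m` is `exp((m' - m)² / v)` times the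
  -- likelihood ratio for twice that shift, whose integral is `1`.
  have h := gaussianReal_eq_withDensity_of_mean m (2 * m' - m) hv
  have h1 := measure_univ (μ := gaussianReal (2 * m' - m) v)
  rw [h, withDensity_apply _ MeasurableSet.univ, Measure.restrict_univ] at h1
  rw [← mul_one (ENNReal.ofReal (Real.exp ((m' - m) ^ 2 / v))), ← h1,
    ← lintegral_const_mul _ (by fun_prop)]
  refine lintegral_congr fun x => ?_
  rw [← ENNReal.ofReal_pow (by positivity), ← ENNReal.ofReal_mul (by positivity), ← Real.exp_add,
    ← Real.exp_nat_mul]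
  congr 2
  field_simp
  ring

end Gaussian

/-! ### Square summable shifts of Gaussian sequences -/

section CameronMartin

/-- The law of independent Gaussian coordinates with means `m j` and common variance `w`. -/
def gaussianSeq (m : ℕ → ℝ) (w : ℝ≥0) : Measure (ℕ → ℝ) :=
  Measure.infinitePi fun j => gaussianReal (m j) w

instance (m : ℕ → ℝ) (w : ℝ≥0) : IsProbabilityMeasure (gaussianSeq m w) :=
  inferInstanceAs (IsProbabilityMeasure (Measure.infinitePi _))

/-- The finite-dimensional likelihood ratio `F` has a second moment bounded independently of `I`,
because the shift is square summable. That uniformity lets the estimate pass to open sets and then,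
by outer regularity, to null sets. -/
theorem gaussianSeq_cylinder_le {m m' : ℕ → ℝ} {w : ℝ≥0} (hw : w ≠ 0)
    (hm : Summable fun j => (m' j - m j) ^ 2) (I : Finset ℕ) {B : Set (I → ℝ)}
    (hB : MeasurableSet B) {δ : ℝ≥0∞} (hδ : δ ≠ 0) (hδ' : δ ≠ ∞) :
    gaussianSeq m' w (I.restrict ⁻¹' B) ≤
      δ * ENNReal.ofReal (Real.exp ((∑' j, (m' j - m j) ^ 2) / w)) +
        δ⁻¹ * gaussianSeq m w (I.restrict ⁻¹' B) := by
  classical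
  have hres : Measurable (I.restrict : (ℕ → ℝ) → (I → ℝ)) := Finset.measurable_restrict I
  set f : ℕ → ℝ → ℝ≥0∞ := fun j x =>
    ENNReal.ofReal (Real.exp (((m' j - m j) * (x - m j) - (m' j - m j) ^ 2 / 2) / w)) with hf
  have hfm : ∀ j, Measurable (f j) := fun j => by fun_prop
  set F : (ℕ → ℝ) → ℝ≥0∞ := fun x => ∏ i ∈ I, f i (x i) with hF
  have hFm : Measurable F :=
    Finset.measurable_prod _ fun i _ => (hfm i).comp (measurable_pi_apply i)
  have h1 : gaussianSeq m' w (I.restrict ⁻¹' B) =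
      gaussianSeq (fun j => if j ∈ I then m' j else m j) w (I.restrict ⁻¹' B) := by
    rw [gaussianSeq, gaussianSeq, ← Measure.map_apply hres hB, ← Measure.map_apply hres hB,
      Measure.infinitePi_map_restrict, Measure.infinitePi_map_restrict]
    congr 2 with j
    simp
  have h2 : gaussianSeq (fun j => if j ∈ I then m' j else m j) w =
      (gaussianSeq m w).withDensity F := by
    refine infinitePi_withDensity_prod _ _ I hfm (fun i hi => ?_) (fun i hi => ?_)
    · simp only [hi, if_true]
      exact gaussianReal_eq_withDensity_of_mean _ _ hw
    · simp only [hi, if_false]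
  have h3 : ∫⁻ x, F x ^ 2 ∂(gaussianSeq m w) ≤
      ENNReal.ofReal (Real.exp ((∑' j, (m' j - m j) ^ 2) / w)) := by
    simp only [hF, ← Finset.prod_pow]
    rw [gaussianSeq, lintegral_prod_infinitePi _ I (f := fun i x => f i x ^ 2)
      (fun i => (hfm i).pow_const 2)]
    simp only [hf, lintegral_exp_linear_gaussianReal _ _ hw]
    rw [← ENNReal.ofReal_prod_of_nonneg (fun _ _ => (Real.exp_pos _).le), ← Real.exp_sum,
      ← Finset.sum_div]
    gcongr
    exact hm.sum_le_tsum _ fun _ _ => sq_nonneg _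
  rw [h1, h2, withDensity_apply _ (hres hB), ← lintegral_indicator (hres hB)]
  calc ∫⁻ x, (I.restrict ⁻¹' B).indicator F x ∂(gaussianSeq m w)
      ≤ ∫⁻ x, δ * F x ^ 2 + δ⁻¹ * (I.restrict ⁻¹' B).indicator 1 x ∂(gaussianSeq m w) := by
        refine lintegral_mono fun x => ?_
        by_cases hx : x ∈ I.restrict ⁻¹' B
        · rw [Set.indicator_of_mem hx, Set.indicator_of_mem hx, Pi.one_apply, mul_one]
          -- Either `F ≤ δ⁻¹`, or `δ F ≥ 1` and then `F ≤ δ F²`.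
          rcases le_total (F x) δ⁻¹ with h | h
          · exact h.trans le_add_self
          · refine le_trans ?_ le_self_add
            calc F x = δ * δ⁻¹ * F x := by rw [ENNReal.mul_inv_cancel hδ hδ', one_mul]
              _ ≤ δ * F x * F x := by gcongr
              _ = δ * F x ^ 2 := by ring
        · rw [Set.indicator_of_notMem hx]
          exact zero_le
    _ = δ * ∫⁻ x, F x ^ 2 ∂(gaussianSeq m w) + δ⁻¹ * gaussianSeq m w (I.restrict ⁻¹' B) := by
        rw [lintegral_add_left (by fun_prop), lintegral_const_mul _ (by fun_prop),
          lintegral_const_mul _ (measurable_one.indicator (hres hB)),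
          lintegral_indicator_one (hres hB)]
    _ ≤ _ := by gcongr

/-- In the product topology an open set is the directed union of the open cylinders it contains, and
the cylinder bound does not depend on the index set. -/
theorem gaussianSeq_isOpen_le {m m' : ℕ → ℝ} {w : ℝ≥0} (hw : w ≠ 0)
    (hm : Summable fun j => (m' j - m j) ^ 2) {U : Set (ℕ → ℝ)} (hU : IsOpen U)
    {δ : ℝ≥0∞} (hδ : δ ≠ 0) (hδ' : δ ≠ ∞) :
    gaussianSeq m' w U ≤
      δ * ENNReal.ofReal (Real.exp ((∑' j, (m' j - m j) ^ 2) / w)) +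
        δ⁻¹ * gaussianSeq m w U := by
  set W : ∀ I : Finset ℕ, Set (I → ℝ) := fun I =>
    ⋃₀ {V | IsOpen V ∧ (I.restrict : (ℕ → ℝ) → (I → ℝ)) ⁻¹' V ⊆ U} with hW
  have hWo : ∀ I, IsOpen (W I) := fun I => isOpen_sUnion fun V hV => hV.1
  set T : Finset ℕ → Set (ℕ → ℝ) := fun I => I.restrict ⁻¹' W I with hT
  have hTU : ∀ I, T I ⊆ U := by
    rintro I x ⟨V, hV, hxV⟩
    exact hV.2 hxV
  have hmono : Monotone T := by
    rintro I J hIJ x ⟨V, hV, hxV⟩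
    have hc : Continuous fun (y : J → ℝ) (i : I) => y ⟨i, hIJ i.2⟩ := by fun_prop
    exact ⟨_, ⟨hV.1.preimage hc, hV.2⟩, hxV⟩
  have hUn : ⋃ I, T I = U := by
    refine Set.Subset.antisymm (Set.iUnion_subset hTU) fun x hx => ?_
    obtain ⟨I, u, hu, hIu⟩ := isOpen_pi_iff.1 hU x hx
    refine Set.mem_iUnion.2 ⟨I, Set.pi Set.univ fun i : I => u i, ⟨?_, ?_⟩, ?_⟩
    · exact isOpen_set_pi Set.finite_univ fun i _ => (hu i i.2).1
    · exact fun y hy => hIu fun i hi => hy ⟨i, hi⟩ trivial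
    · exact fun i _ => (hu i i.2).2
  rw [← hUn, hmono.directed_le.measure_iUnion, hUn]
  refine iSup_le fun I => (gaussianSeq_cylinder_le hw hm I (hWo I).measurableSet hδ hδ').trans ?_
  gcongr
  exact hTU I

/-- Shifting a Gaussian sequence by a square summable sequence preserves null sets. -/
theorem gaussianSeq_absolutelyContinuous {m m' : ℕ → ℝ} {w : ℝ≥0} (hw : w ≠ 0)
    (hm : Summable fun j => (m' j - m j) ^ 2) : gaussianSeq m' w ≪ gaussianSeq m w := by
  intro A hA
  set c : ℝ≥0∞ := ENNReal.ofReal (Real.exp ((∑' j, (m' j - m j) ^ 2) / w)) + 1 with hc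
  have hc' : c ≠ ∞ := by simp [hc]
  refine le_antisymm (ENNReal.le_of_forall_pos_le_add fun η hη _ => ?_) zero_le
  set δ : ℝ≥0∞ := η / c with hδdef
  have hδ : δ ≠ 0 := (ENNReal.div_pos (by exact_mod_cast hη.ne') hc').ne'
  have hδ' : δ ≠ ∞ := ENNReal.div_ne_top ENNReal.coe_ne_top (by simp [hc])
  -- Mass below `δ²` absorbs the factor `δ⁻¹` of the open-set bound, leaving a total of `δ * c = η`.
  obtain ⟨U, hAU, hU, hUδ⟩ := A.exists_isOpen_lt_of_lt (μ := gaussianSeq m w) (δ * δ)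
    (by rw [hA]; positivity)
  rw [zero_add]
  calc gaussianSeq m' w A ≤ gaussianSeq m' w U := measure_mono hAU
    _ ≤ _ := gaussianSeq_isOpen_le hw hm hU hδ hδ'
    _ ≤ δ * ENNReal.ofReal (Real.exp ((∑' j, (m' j - m j) ^ 2) / w)) + δ⁻¹ * (δ * δ) := by gcongr
    _ = δ * c := by
        rw [← mul_assoc, ENNReal.inv_mul_cancel hδ hδ', one_mul, hc]
        ring
    _ = η := ENNReal.div_mul_cancel (by simp [hc]) hc'

end CameronMartin

/-! ### The posterior as an explicit mixture -/

section PosteriorFormula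

theorem obsLaw_eq_gaussianSeq (lam : ℕ → ℝ) {ε : ℝ} (hε : 0 < ε) (θ : ℕ → ℝ) :
    obsLaw lam ε θ = gaussianSeq (fun j => lam j * θ j) ε.toNNReal := by
  rw [obsLaw, Measure.infinitePi_map_pi (f := fun j x => lam j * θ j + √ε * x) _
    (fun j => by fun_prop), gaussianSeq]
  congr 1 with j : 1
  have h : (fun x => lam j * θ j + √ε * x) = (fun x => lam j * θ j + x) ∘ fun x => √ε * x := rfl
  rw [h, ← Measure.map_map (by fun_prop) (by fun_prop), gaussianReal_map_const_mul,
    gaussianReal_map_const_add, mul_zero, zero_add, mul_one]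
  congr 1
  exact NNReal.eq (by simp [Real.sq_sqrt hε.le, hε.le])

theorem obsKernel_eq_piKernel (lam : ℕ → ℝ) {ε : ℝ} (hε : 0 < ε) :
    obsKernel lam ε = piKernel fun j => linGauss (lam j) 0 ε.toNNReal := by
  ext1 θ
  refine (obsLaw_eq_gaussianSeq lam hε θ).trans ?_
  simp only [gaussianSeq, piKernel_apply, linGauss_apply, add_zero]

/-- The variance of coordinate `j` under the sieve prior of dimension `m`. -/
def sieveVar (v : ℕ → ℝ) (m j : ℕ) : ℝ≥0 := if j < m then (v j).toNNReal else 0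

/-- The marginal law of the observation under the sieve prior of dimension `m`. -/
def sieveEvidence (lam μ v : ℕ → ℝ) (ε : ℝ) (m : ℕ) : Measure (ℕ → ℝ) :=
  Measure.infinitePi fun j =>
    gaussianReal (lam j * μ j) ((lam j ^ 2).toNNReal * sieveVar v m j + ε.toNNReal)

/-- The factor by which the posterior mean depends on the observation. -/
def sieveSlope (lam v : ℕ → ℝ) (ε : ℝ) (m j : ℕ) : ℝ :=
  lam j * sieveVar v m j / (lam j ^ 2 * sieveVar v m j + ε.toNNReal)

/-- The posterior of the sieve prior of dimension `m`. -/
def sievePosterior (lam μ v : ℕ → ℝ) (ε : ℝ) (m : ℕ) : Kernel (ℕ → ℝ) (ℕ → ℝ) :=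
  piKernel fun j => linGauss (sieveSlope lam v ε m j)
    (μ j - sieveSlope lam v ε m j * (lam j * μ j))
    (sieveVar v m j * ε.toNNReal / ((lam j ^ 2).toNNReal * sieveVar v m j + ε.toNNReal))

instance (lam μ v : ℕ → ℝ) (ε : ℝ) (m : ℕ) : IsProbabilityMeasure (sieveEvidence lam μ v ε m) :=
  inferInstanceAs (IsProbabilityMeasure (Measure.infinitePi _))

instance (lam μ v : ℕ → ℝ) (ε : ℝ) (m : ℕ) : IsMarkovKernel (sievePosterior lam μ v ε m) :=
  inferInstanceAs (IsMarkovKernel (piKernel _))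

theorem sievePrior_compProd_swap (lam μ v : ℕ → ℝ) {ε : ℝ} (hε : 0 < ε) (m : ℕ) :
    (sievePrior μ v m ⊗ₘ obsKernel lam ε).map Prod.swap =
      sieveEvidence lam μ v ε m ⊗ₘ sievePosterior lam μ v ε m := by
  rw [obsKernel_eq_piKernel lam hε]
  exact infinitePi_compProd_piKernel_swap fun j =>
    gaussianReal_compProd_linGauss_swap (lam j) (μ j) (sieveVar v m j)
      (Real.toNNReal_pos.2 hε).ne'

/-- The weight of a coordinate in the posterior mean. -/
def gain (lam v : ℕ → ℝ) (ε : ℝ) (j : ℕ) : ℝ := lam j ^ 2 * v j / (lam j ^ 2 * v j + ε)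

/-- The unnormalized posterior weight of dimension `m`. -/
def modelWeight (lam μ v : ℕ → ℝ) (C ε : ℝ) (m : ℕ) (Y : ℕ → ℝ) : ℝ :=
  Real.exp (-3 * C * m / 2 +
    ∑ j ∈ Finset.range m, gain lam v ε j / (2 * ε) * (Y j - lam j * μ j) ^ 2)

/-- The posterior probability of dimension `m`. -/
def modelProb (lam μ v : ℕ → ℝ) (C ε : ℝ) (m : ℕ) (Y : ℕ → ℝ) : ℝ :=
  modelWeight lam μ v C ε m Y /
    ∑ k ∈ Finset.Icc 1 (maxDim lam ε), modelWeight lam μ v C ε k Y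

theorem modelWeight_pos (lam μ v : ℕ → ℝ) (C ε : ℝ) (m : ℕ) (Y : ℕ → ℝ) :
    0 < modelWeight lam μ v C ε m Y := Real.exp_pos _

@[fun_prop]
theorem measurable_modelWeight (lam μ v : ℕ → ℝ) (C ε : ℝ) (m : ℕ) :
    Measurable (modelWeight lam μ v C ε m) := by
  unfold modelWeight
  fun_prop

@[fun_prop]
theorem measurable_modelProb (lam μ v : ℕ → ℝ) (C ε : ℝ) (m : ℕ) :
    Measurable (modelProb lam μ v C ε m) := by
  unfold modelProb
  fun_prop

/-- All the marginal laws are compared with one reference measure, the law of the data at the prior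
mean, so that they can be added over `m`. -/
theorem dimWeight_smul_sieveEvidence (lam μ v : ℕ → ℝ) (C : ℝ) {ε : ℝ} (hε : 0 < ε) {m : ℕ}
    (hv : ∀ j < m, 0 < v j) :
    ENNReal.ofReal (dimWeight lam v C ε m) • sieveEvidence lam μ v ε m =
      (gaussianSeq (fun j => lam j * μ j) ε.toNNReal).withDensity
        fun Y => ENNReal.ofReal (modelWeight lam μ v C ε m Y) := by
  set f : ℕ → ℝ → ℝ≥0∞ := fun j x => ENNReal.ofReal
    (√(ε / (lam j ^ 2 * v j + ε)) *
      Real.exp ((1 / ε - 1 / (lam j ^ 2 * v j + ε)) / 2 * (x - lam j * μ j) ^ 2)) with hf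
  have hfm : ∀ j, Measurable (f j) := fun j => by fun_prop
  have hε' : ε.toNNReal ≠ 0 := (Real.toNNReal_pos.2 hε).ne'
  have h1 : sieveEvidence lam μ v ε m =
      (gaussianSeq (fun j => lam j * μ j) ε.toNNReal).withDensity
        fun Y => ∏ j ∈ Finset.range m, f j (Y j) := by
    refine infinitePi_withDensity_prod _ _ (Finset.range m) hfm (fun j hj => ?_) (fun j hj => ?_)
    · have hj := Finset.mem_range.1 hj
      rw [gaussianReal_eq_withDensity_of_var (lam j * μ j) hε' (by positivity)]
      simp only [hf, sieveVar, hj, if_true, NNReal.coe_add, NNReal.coe_mul,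
        Real.coe_toNNReal _ (sq_nonneg _), Real.coe_toNNReal _ (hv j hj).le,
        Real.coe_toNNReal _ hε.le]
    · have hj : ¬ j < m := fun h => hj (Finset.mem_range.2 h)
      simp [sieveVar, hj]
  have hFm : Measurable fun Y : ℕ → ℝ => ∏ j ∈ Finset.range m, f j (Y j) :=
    Finset.measurable_prod _ fun i _ => (hfm i).comp (measurable_pi_apply i)
  rw [h1, ← withDensity_smul _ hFm]
  congr 1 with Y
  rw [Pi.smul_apply, smul_eq_mul, hf, ← ENNReal.ofReal_prod_of_nonneg (fun _ _ => by positivity),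
    ← ENNReal.ofReal_mul (by unfold dimWeight; positivity)]
  congr 1
  rw [dimWeight, modelWeight, Real.exp_add, Real.exp_sum, mul_assoc, ← Finset.prod_mul_distrib]
  congr 1
  refine Finset.prod_congr rfl fun j hj => ?_
  have hvj := hv j (Finset.mem_range.1 hj)
  have hp : 0 < lam j ^ 2 * v j + ε := by positivity
  -- The prior factor is exactly the inverse of the variance ratio in the marginal density, so the
  -- two square roots cancel.
  have h2 : v j / postVar lam v ε j = (ε / (lam j ^ 2 * v j + ε))⁻¹ := by
    rw [postVar]
    field_simp
  rw [h2, ← mul_assoc, Real.sqrt_inv, inv_mul_cancel₀ (by positivity), one_mul, gain]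
  congr 2
  field_simp
  ring

theorem one_le_maxDim (lam : ℕ → ℝ) {ε : ℝ} (hε : 0 < ε) (hε1 : ε ≤ 1) : 1 ≤ maxDim lam ε := by
  refine le_csSup ⟨⌊ε⁻¹⌋₊, fun m hm => hm.2.1⟩ ⟨le_rfl, ?_, ?_⟩
  · exact Nat.le_floor (by simpa using (one_le_inv₀ hε).2 hε1)
  · refine mul_le_of_le_one_left (Real.iSup_nonneg fun j => by positivity) hε1

variable {lam μ v : ℕ → ℝ} {C ε : ℝ}

theorem lintegral_hierPrior (f : (ℕ → ℝ) → ℝ≥0∞) :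
    ∫⁻ θ, f θ ∂(hierPrior lam μ v C ε) = ∑ m ∈ Finset.Icc 1 (maxDim lam ε),
      ENNReal.ofReal (dimPrior lam v C ε m) * ∫⁻ θ, f θ ∂(sievePrior μ v m) := by
  simp [hierPrior, lintegral_finsetSum_measure]

theorem sum_dimWeight_pos (hε : 0 < ε) (hε1 : ε ≤ 1) (hv : ∀ j < maxDim lam ε, 0 < v j) :
    0 < ∑ k ∈ Finset.Icc 1 (maxDim lam ε), dimWeight lam v C ε k := by
  refine Finset.sum_pos (fun m hm => ?_) ⟨1, Finset.mem_Icc.2 ⟨le_rfl, one_le_maxDim lam hε hε1⟩⟩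
  have hm := Finset.mem_Icc.1 hm
  refine mul_pos (Real.exp_pos _) (Finset.prod_pos fun j hj => Real.sqrt_pos.2 ?_)
  have hvj := hv j ((Finset.mem_range.1 hj).trans_le hm.2)
  rw [postVar]
  positivity

theorem sum_modelWeight_pos (μ v : ℕ → ℝ) (C : ℝ) (hε : 0 < ε) (hε1 : ε ≤ 1) (Y : ℕ → ℝ) :
    0 < ∑ k ∈ Finset.Icc 1 (maxDim lam ε), modelWeight lam μ v C ε k Y :=
  Finset.sum_pos (fun _ _ => modelWeight_pos ..)
    ⟨1, Finset.mem_Icc.2 ⟨le_rfl, one_le_maxDim lam hε hε1⟩⟩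

theorem dimPrior_smul_sieveEvidence (hε : 0 < ε) (hε1 : ε ≤ 1)
    (hv : ∀ j < maxDim lam ε, 0 < v j) {m : ℕ} (hm : m ≤ maxDim lam ε) :
    ENNReal.ofReal (dimPrior lam v C ε m) • sieveEvidence lam μ v ε m =
      (gaussianSeq (fun j => lam j * μ j) ε.toNNReal).withDensity fun Y =>
        ENNReal.ofReal (modelWeight lam μ v C ε m Y /
          ∑ k ∈ Finset.Icc 1 (maxDim lam ε), dimWeight lam v C ε k) := by
  have hZ := sum_dimWeight_pos (C := C) hε hε1 hv
  simp only [dimPrior, div_eq_mul_inv, mul_comm _ (∑ k ∈ _, _)⁻¹,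
    ENNReal.ofReal_mul (inv_nonneg.2 hZ.le)]
  rw [mul_smul, dimWeight_smul_sieveEvidence lam μ v C hε fun j hj => hv j (hj.trans_le hm),
    ← withDensity_smul _ (by fun_prop)]
  rfl

theorem obsKernel_comp_sievePrior (hε : 0 < ε) (m : ℕ) :
    obsKernel lam ε ∘ₘ sievePrior μ v m = sieveEvidence lam μ v ε m := by
  rw [← Measure.snd_compProd, ← Measure.fst_map_swap, sievePrior_compProd_swap lam μ v hε,
    Measure.fst_compProd]

theorem obsKernel_comp_hierPrior (hε : 0 < ε) (hε1 : ε ≤ 1)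
    (hv : ∀ j < maxDim lam ε, 0 < v j) :
    obsKernel lam ε ∘ₘ hierPrior lam μ v C ε =
      (gaussianSeq (fun j => lam j * μ j) ε.toNNReal).withDensity fun Y =>
        ENNReal.ofReal ((∑ k ∈ Finset.Icc 1 (maxDim lam ε), modelWeight lam μ v C ε k Y) /
          ∑ k ∈ Finset.Icc 1 (maxDim lam ε), dimWeight lam v C ε k) := by
  have hZ := sum_dimWeight_pos (C := C) hε hε1 hv
  ext s hs
  rw [Measure.bind_apply hs (Kernel.aemeasurable _), lintegral_hierPrior,
    withDensity_apply _ hs]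
  simp only [Finset.sum_div]
  simp_rw [ENNReal.ofReal_sum_of_nonneg fun k (_ : k ∈ Finset.Icc 1 (maxDim lam ε)) =>
    div_nonneg (modelWeight_pos lam μ v C ε k _).le hZ.le]
  rw [lintegral_finsetSum _ fun k _ => by fun_prop]
  refine Finset.sum_congr rfl fun m hm => ?_
  rw [← withDensity_apply _ hs, ← dimPrior_smul_sieveEvidence hε hε1 hv (Finset.mem_Icc.1 hm).2,
    Measure.smul_apply, ← obsKernel_comp_sievePrior hε,
    Measure.bind_apply hs (Kernel.aemeasurable _), smul_eq_mul]

instance (lam μ v : ℕ → ℝ) (C ε : ℝ) : IsMarkovKernel (hierPosterior lam μ v C ε) :=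
  inferInstanceAs (IsMarkovKernel (posterior _ _))

/-- Both sides have the same integral over every measurable set of observations: the joint law is
the mixture of the sieve joint laws, each of which disintegrates by conjugacy. The normalizer of the
prior weights cancels. -/
theorem hierPosterior_apply_ae_eq (hε : 0 < ε) (hε1 : ε ≤ 1)
    (hv : ∀ j < maxDim lam ε, 0 < v j) {B : Set (ℕ → ℝ)} (hB : MeasurableSet B) :
    (fun Y => hierPosterior lam μ v C ε Y B) =ᵐ[obsKernel lam ε ∘ₘ hierPrior lam μ v C ε]
      fun Y => ∑ m ∈ Finset.Icc 1 (maxDim lam ε),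
        ENNReal.ofReal (modelProb lam μ v C ε m Y) * sievePosterior lam μ v ε m Y B := by
  have hZ := sum_dimWeight_pos (C := C) hε hε1 hv
  have hmK : ∀ m, Measurable fun Y => sievePosterior lam μ v ε m Y B := fun m =>
    Kernel.measurable_coe _ hB
  have hterm : ∀ m, Measurable fun Y =>
      ENNReal.ofReal (modelProb lam μ v C ε m Y) * sievePosterior lam μ v ε m Y B := fun m =>
    (measurable_modelProb lam μ v C ε m).ennreal_ofReal.mul (hmK m)
  refine ae_eq_of_forall_setLIntegral_eq_of_sigmaFinite (Kernel.measurable_coe _ hB)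
    (Finset.measurable_sum _ fun m _ => hterm m) fun A hA _ => ?_
  have hL : ∫⁻ Y in A, hierPosterior lam μ v C ε Y B ∂(obsKernel lam ε ∘ₘ hierPrior lam μ v C ε) =
      ∑ m ∈ Finset.Icc 1 (maxDim lam ε), ENNReal.ofReal (dimPrior lam v C ε m) *
        ∫⁻ Y in A, sievePosterior lam μ v ε m Y B ∂(sieveEvidence lam μ v ε m) := by
    rw [← Measure.compProd_apply_prod hA hB, hierPosterior, compProd_posterior_eq_map_swap,
      Measure.map_apply measurable_swap (hA.prod hB), Set.preimage_swap_prod,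
      Measure.compProd_apply_prod hB hA, ← lintegral_indicator hB, lintegral_hierPrior]
    refine Finset.sum_congr rfl fun m _ => ?_
    rw [lintegral_indicator hB, ← Measure.compProd_apply_prod hB hA,
      ← Measure.compProd_apply_prod hA hB, ← sievePrior_compProd_swap lam μ v hε,
      Measure.map_apply measurable_swap (hA.prod hB), Set.preimage_swap_prod]
  rw [hL, lintegral_finsetSum _ fun m _ => hterm m]
  refine Finset.sum_congr rfl fun m hm => ?_
  rw [← smul_eq_mul, ← lintegral_smul_measure, ← Measure.restrict_smul,
    dimPrior_smul_sieveEvidence hε hε1 hv (Finset.mem_Icc.1 hm).2,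
    obsKernel_comp_hierPrior hε hε1 hv,
    setLIntegral_withDensity_eq_setLIntegral_mul _ (by fun_prop) (hmK m) hA,
    setLIntegral_withDensity_eq_setLIntegral_mul _ (by fun_prop) (hterm m) hA]
  refine lintegral_congr fun Y => ?_
  have hS := sum_modelWeight_pos (lam := lam) μ v C hε hε1 Y
  rw [Pi.mul_apply, Pi.mul_apply, ← mul_assoc, ← ENNReal.ofReal_mul (by positivity), modelProb]
  congr 2
  field_simp

/-- The marginal law has a positive density with respect to the Gaussian sequence centred at the
prior mean, and `obsLaw` is a square summable shift of that sequence. This makes the almost sure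
posterior formula usable under the true parameter. -/
theorem obsLaw_absolutelyContinuous {θ₀ : ℕ → ℝ} (hε : 0 < ε) (hε1 : ε ≤ 1)
    (hv : ∀ j < maxDim lam ε, 0 < v j)
    (hsum : Summable fun j => (lam j * θ₀ j - lam j * μ j) ^ 2) :
    obsLaw lam ε θ₀ ≪ obsKernel lam ε ∘ₘ hierPrior lam μ v C ε := by
  rw [obsLaw_eq_gaussianSeq lam hε, obsKernel_comp_hierPrior hε hε1 hv]
  refine (gaussianSeq_absolutelyContinuous (Real.toNNReal_pos.2 hε).ne' hsum).trans
    (withDensity_absolutelyContinuous' (by fun_prop) (ae_of_all _ fun Y => ?_))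
  have h1 := sum_dimWeight_pos (C := C) hε hε1 hv
  have h2 := sum_modelWeight_pos (lam := lam) μ v C hε hε1 Y
  exact (ENNReal.ofReal_pos.2 (by positivity)).ne'

theorem lintegral_hierPosterior {θ₀ : ℕ → ℝ} (hε : 0 < ε) (hε1 : ε ≤ 1)
    (hv : ∀ j < maxDim lam ε, 0 < v j)
    (hsum : Summable fun j => (lam j * θ₀ j - lam j * μ j) ^ 2)
    {B : Set (ℕ → ℝ)} (hB : MeasurableSet B) :
    ∫⁻ Y, hierPosterior lam μ v C ε Y B ∂(obsLaw lam ε θ₀) =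
      ∑ m ∈ Finset.Icc 1 (maxDim lam ε), ∫⁻ Y, ENNReal.ofReal (modelProb lam μ v C ε m Y) *
        sievePosterior lam μ v ε m Y B ∂(obsLaw lam ε θ₀) := by
  rw [lintegral_congr_ae ((obsLaw_absolutelyContinuous hε hε1 hv hsum).ae_eq
    (hierPosterior_apply_ae_eq hε hε1 hv hB)), lintegral_finsetSum]
  exact fun m _ => (measurable_modelProb lam μ v C ε m).ennreal_ofReal.mul
    (Kernel.measurable_coe _ hB)

end PosteriorFormula

/-! ### The oracle dimension and rate -/

section Oracle

variable {lam θ₀ μ v : ℕ → ℝ} {d C L ε ε₀ : ℝ}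

theorem invSq_le_maxInvSq (lam : ℕ → ℝ) {j m : ℕ} (h : j < m) :
    (lam j ^ 2)⁻¹ ≤ maxInvSq lam m :=
  le_ciSup (f := fun j : Fin m => (lam j ^ 2)⁻¹) (Set.finite_range _).bddAbove ⟨j, h⟩

theorem maxInvSq_mono (lam : ℕ → ℝ) : Monotone (maxInvSq lam) := fun m n hmn =>
  Real.iSup_le (fun j => invSq_le_maxInvSq lam (j.2.trans_le hmn))
    (Real.iSup_nonneg fun j => by positivity)

theorem maxInvSq_pos (hlam : ∀ j, lam j ≠ 0) {m : ℕ} (hm : 1 ≤ m) : 0 < maxInvSq lam m := by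
  have := hlam 0
  exact lt_of_lt_of_le (by positivity) (invSq_le_maxInvSq lam hm)

theorem meanInvSq_pos (hlam : ∀ j, lam j ≠ 0) {m : ℕ} (hm : 1 ≤ m) : 0 < meanInvSq lam m := by
  refine mul_pos (by positivity) (Finset.sum_pos (fun j _ => ?_) ⟨0, Finset.mem_range.2 hm⟩)
  have := hlam j
  positivity

theorem natCast_mul_meanInvSq (lam : ℕ → ℝ) {m : ℕ} (hm : 1 ≤ m) :
    m * meanInvSq lam m = ∑ j ∈ Finset.range m, (lam j ^ 2)⁻¹ := by
  have : (m : ℝ) ≠ 0 := by positivity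
  rw [meanInvSq, mul_inv_cancel_left₀ this]

theorem OperatorRegular.maxInvSq_le (hop : OperatorRegular lam C L) (hlam : ∀ j, lam j ≠ 0)
    {m : ℕ} (hm : 1 ≤ m) : maxInvSq lam m ≤ L * meanInvSq lam m :=
  (div_le_iff₀ (meanInvSq_pos hlam hm)).1 (hop.max_mean m hm).2

theorem OperatorRegular.meanInvSq_le (hop : OperatorRegular lam C L) (hlam : ∀ j, lam j ≠ 0)
    {m : ℕ} (hm : 1 ≤ m) : meanInvSq lam m ≤ maxInvSq lam m :=
  (one_le_div (meanInvSq_pos hlam hm)).1 (hop.max_mean m hm).1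

theorem OperatorRegular.one_le_maxInvSq (hop : OperatorRegular lam C L) (hlam : ∀ j, lam j ≠ 0)
    {m : ℕ} (hm : 1 ≤ m) : 1 ≤ maxInvSq lam m := by
  refine le_trans ?_ (maxInvSq_mono lam hm)
  -- Submultiplicativity at `1` reads `Λ_(1) ≤ Λ_(1)²`, which forces `Λ_(1) ≥ 1`.
  have h := hop.submul 1 1 le_rfl le_rfl
  rw [one_mul] at h
  exact le_of_mul_le_mul_right (by simpa using h) (maxInvSq_pos hlam le_rfl)

theorem OperatorRegular.sq_le (hop : OperatorRegular lam C L) (hlam : ∀ j, lam j ≠ 0) (j : ℕ) :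
    lam j ^ 2 ≤ max (lam 0 ^ 2) C := by
  rcases Nat.eq_zero_or_pos j with rfl | hj
  · exact le_max_left _ _
  · refine le_trans ?_ (le_max_right _ _)
    have h := hop.tail_le 1 le_rfl (j - 1)
    rw [Nat.add_sub_cancel' hj] at h
    refine h.trans (mul_le_of_le_one_right (zero_le_one.trans hop.one_le_C) ?_)
    exact inv_le_one_of_one_le₀ (hop.one_le_maxInvSq hlam le_rfl)

theorem summable_sq_sub (hθ₀ : Summable fun j => θ₀ j ^ 2) (hμ : Summable fun j => μ j ^ 2) :
    Summable fun j => (θ₀ j - μ j) ^ 2 := by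
  refine Summable.of_nonneg_of_le (fun j => sq_nonneg _) (fun j => ?_)
    ((hθ₀.add hμ).mul_left 2)
  nlinarith [sq_nonneg (θ₀ j + μ j)]

theorem bias_nonneg (θ₀ μ : ℕ → ℝ) (m : ℕ) : 0 ≤ bias θ₀ μ m := tsum_nonneg fun _ => sq_nonneg _

theorem sum_add_bias (hβ : Summable fun j => (θ₀ j - μ j) ^ 2) (m : ℕ) :
    ∑ j ∈ Finset.range m, (θ₀ j - μ j) ^ 2 + bias θ₀ μ m = ∑' j, (θ₀ j - μ j) ^ 2 := by
  rw [← hβ.sum_add_tsum_nat_add m, bias]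
  simp only [add_comm m]

theorem bias_add_sum_Ico (hβ : Summable fun j => (θ₀ j - μ j) ^ 2) {m n : ℕ} (h : m ≤ n) :
    bias θ₀ μ n + ∑ j ∈ Finset.Ico m n, (θ₀ j - μ j) ^ 2 = bias θ₀ μ m := by
  have h1 := sum_add_bias hβ m
  have h2 := sum_add_bias hβ n
  rw [← Finset.sum_range_add_sum_Ico _ h] at h2
  linarith

theorem bias_antitone (hβ : Summable fun j => (θ₀ j - μ j) ^ 2) : Antitone (bias θ₀ μ) :=
  fun m n h => by
    rw [← bias_add_sum_Ico hβ h]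
    exact le_add_of_nonneg_right (Finset.sum_nonneg fun _ _ => sq_nonneg _)

theorem tendsto_bias (θ₀ μ : ℕ → ℝ) : Tendsto (bias θ₀ μ) atTop (𝓝 0) := by
  have h := tendsto_sum_nat_add fun j => (θ₀ j - μ j) ^ 2
  refine h.congr fun m => ?_
  simp only [bias, add_comm m]

theorem OperatorRegular.mul_maxInvSq_le_rate (hop : OperatorRegular lam C L)
    (hlam : ∀ j, lam j ≠ 0) (hε : 0 < ε) {m : ℕ} (hm : 1 ≤ m) :
    ε * m * maxInvSq lam m ≤ L * rate lam θ₀ μ ε m := by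
  calc ε * m * maxInvSq lam m ≤ ε * m * (L * meanInvSq lam m) := by
        gcongr
        exact hop.maxInvSq_le hlam hm
    _ = L * (ε * m * meanInvSq lam m) := by ring
    _ ≤ _ := mul_le_mul_of_nonneg_left (le_max_right _ _) (zero_le_one.trans hop.one_le_L)

theorem oracleDim_mem (hop : OperatorRegular lam C L) (hlam : ∀ j, lam j ≠ 0) (hε : 0 < ε) :
    1 ≤ oracleDim lam θ₀ μ ε ∧ ∀ k : ℕ, 1 ≤ k →
      rate lam θ₀ μ ε (oracleDim lam θ₀ μ ε) ≤ rate lam θ₀ μ ε k := by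
  have hL : 0 < L := one_pos.trans_le hop.one_le_L
  refine Nat.sInf_mem (s := {m : ℕ | 1 ≤ m ∧ ∀ k : ℕ, 1 ≤ k →
    rate lam θ₀ μ ε m ≤ rate lam θ₀ μ ε k}) ?_
  -- Beyond `N` the variance term alone makes the rate at least its value at `1`, so a minimizer
  -- over a finite range is a global one.
  obtain ⟨N, hN⟩ := exists_nat_gt (L * rate lam θ₀ μ ε 1 / ε)
  obtain ⟨m, hm, hmin⟩ := Finset.exists_min_image (Finset.Icc 1 (N + 1)) (rate lam θ₀ μ ε)
    ⟨1, by simp⟩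
  refine ⟨m, (Finset.mem_Icc.1 hm).1, fun k hk => ?_⟩
  by_cases hkN : k ≤ N + 1
  · exact hmin k (Finset.mem_Icc.2 ⟨hk, hkN⟩)
  · refine (hmin 1 (by simp)).trans ?_
    have h1 := hop.mul_maxInvSq_le_rate (θ₀ := θ₀) (μ := μ) hlam hε hk
    have h2 := hop.one_le_maxInvSq hlam hk
    rw [div_lt_iff₀ hε] at hN
    have h3 : (N : ℝ) ≤ k := by exact_mod_cast (by omega : N ≤ k)
    have h4 : (N : ℝ) * ε ≤ ε * k * maxInvSq lam k := by
      calc (N : ℝ) * ε ≤ k * ε := by gcongr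
        _ = ε * k * 1 := by ring
        _ ≤ _ := by gcongr
    exact le_of_mul_le_mul_left (hN.le.trans (h4.trans h1)) hL

theorem oracleRate_pos (hop : OperatorRegular lam C L) (hlam : ∀ j, lam j ≠ 0) (hε : 0 < ε) :
    0 < oracleRate lam θ₀ μ ε := by
  have h := (oracleDim_mem (θ₀ := θ₀) (μ := μ) hop hlam hε).1
  refine lt_of_lt_of_le ?_ (le_max_right _ _)
  have := meanInvSq_pos hlam h
  positivity

theorem oracleKappa_mul_le (hop : OperatorRegular lam C L) (hlam : ∀ j, lam j ≠ 0)
    (hε : ε ∈ Set.Ioo 0 ε₀) :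
    oracleKappa lam θ₀ μ ε₀ * oracleRate lam θ₀ μ ε ≤ min (bias θ₀ μ (oracleDim lam θ₀ μ ε))
      (ε * (oracleDim lam θ₀ μ ε : ℝ) * meanInvSq lam (oracleDim lam θ₀ μ ε)) := by
  have hr := oracleRate_pos (θ₀ := θ₀) (μ := μ) hop hlam hε.1
  rw [← le_div_iff₀ hr, div_eq_inv_mul]
  refine csInf_le ⟨0, ?_⟩ ⟨ε, hε, rfl⟩
  rintro _ ⟨η, hη, rfl⟩
  have h1 := oracleRate_pos (θ₀ := θ₀) (μ := μ) hop hlam hη.1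
  have h2 := meanInvSq_pos hlam (oracleDim_mem (θ₀ := θ₀) (μ := μ) hop hlam hη.1).1
  have h3 := hη.1
  exact mul_nonneg (inv_nonneg.2 h1.le) (le_min (bias_nonneg _ _ _) (by positivity))

theorem oracleKappa_le_one (hop : OperatorRegular lam C L) (hlam : ∀ j, lam j ≠ 0)
    (hε₀ : 0 < ε₀) : oracleKappa lam θ₀ μ ε₀ ≤ 1 := by
  have hε : ε₀ / 2 ∈ Set.Ioo 0 ε₀ := ⟨by positivity, by linarith⟩
  have h := oracleKappa_mul_le (θ₀ := θ₀) (μ := μ) hop hlam hε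
  have hr := oracleRate_pos (θ₀ := θ₀) (μ := μ) hop hlam hε.1
  have h2 : oracleKappa lam θ₀ μ ε₀ * oracleRate lam θ₀ μ (ε₀ / 2) ≤
      1 * oracleRate lam θ₀ μ (ε₀ / 2) := by
    rw [one_mul]
    exact h.trans (min_le_left _ _ |>.trans (le_max_left _ _))
  exact le_of_mul_le_mul_right h2 hr

theorem tendsto_oracleRate (hop : OperatorRegular lam C L) (hlam : ∀ j, lam j ≠ 0) :
    Tendsto (oracleRate lam θ₀ μ) (𝓝[>] 0) (𝓝 0) := by
  refine tendsto_order.2 ⟨fun a ha => ?_, fun a ha => ?_⟩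
  · filter_upwards [self_mem_nhdsWithin] with ε hε
    exact ha.trans (oracleRate_pos hop hlam hε)
  · obtain ⟨m, hm, hm1⟩ := (((tendsto_bias θ₀ μ).eventually_lt_const ha).and
      (eventually_ge_atTop 1)).exists
    have hc : Tendsto (fun ε : ℝ => ε * m * meanInvSq lam m) (𝓝[>] 0) (𝓝 0) := by
      have h : Continuous fun ε : ℝ => ε * m * meanInvSq lam m := by fun_prop
      have := h.tendsto 0
      simp only [zero_mul] at this
      exact this.mono_left nhdsWithin_le_nhds
    filter_upwards [self_mem_nhdsWithin, hc.eventually_lt_const ha] with ε hε hεa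
    exact ((oracleDim_mem hop hlam hε).2 m hm1).trans_lt (max_lt hm hεa)

/-- A fixed dimension of positive bias is eventually beaten because the oracle rate tends to `0`.
One of zero bias is never the oracle for `ε < ε₀`, since `κ° > 0` keeps the oracle bias positive. -/
theorem tendsto_oracleDim (hop : OperatorRegular lam C L) (hlam : ∀ j, lam j ≠ 0)
    (hε₀ : 0 < ε₀) (hκ : 0 < oracleKappa lam θ₀ μ ε₀) :
    Tendsto (oracleDim lam θ₀ μ) (𝓝[>] 0) atTop := by
  refine tendsto_atTop.2 fun N => ?_
  have hk : ∀ k ∈ Finset.range N, ∀ᶠ ε in 𝓝[>] (0 : ℝ), oracleDim lam θ₀ μ ε ≠ k := by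
    intro k _
    rcases (bias_nonneg θ₀ μ k).eq_or_lt with h0 | h0
    · filter_upwards [Ioo_mem_nhdsGT hε₀] with ε hε hk
      have h1 := (oracleKappa_mul_le (θ₀ := θ₀) (μ := μ) hop hlam hε).trans (min_le_left _ _)
      rw [hk, ← h0] at h1
      exact h1.not_gt (mul_pos hκ (oracleRate_pos hop hlam hε.1))
    · filter_upwards [(tendsto_oracleRate hop hlam).eventually_lt_const h0] with ε hε hk
      refine hε.not_ge ?_
      rw [oracleRate, hk]
      exact le_max_left _ _
  filter_upwards [(Filter.eventually_all_finset _).2 hk] with ε hε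
  by_contra! h
  exact hε _ (Finset.mem_range.2 h) rfl

/-- Once `L r ≤ 1`, also `ε k Λ_(k) ≤ 1`. Both constraints defining `maxDim` follow from `Λ_(k) ≥
1`, `k ≥ 1` and `Λ_(1) ≥ 1`. -/
theorem eventually_oracleDim_le_maxDim (hop : OperatorRegular lam C L) (hlam : ∀ j, lam j ≠ 0) :
    ∀ᶠ ε in 𝓝[>] (0 : ℝ), oracleDim lam θ₀ μ ε ≤ maxDim lam ε := by
  have hL : 0 < L := one_pos.trans_le hop.one_le_L
  filter_upwards [self_mem_nhdsWithin, (tendsto_oracleRate hop hlam).eventually_lt_const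
    (show (0 : ℝ) < L⁻¹ by positivity)] with ε hε hr
  have hε : 0 < ε := hε
  have h1 := (oracleDim_mem (θ₀ := θ₀) (μ := μ) hop hlam hε).1
  have h2 := hop.mul_maxInvSq_le_rate (θ₀ := θ₀) (μ := μ) hlam hε h1
  have h3 : L * rate lam θ₀ μ ε (oracleDim lam θ₀ μ ε) ≤ 1 := by
    rw [← mul_inv_cancel₀ hL.ne']
    exact mul_le_mul_of_nonneg_left hr.le hL.le
  set m := oracleDim lam θ₀ μ ε
  have h4 := hop.one_le_maxInvSq hlam h1
  have h5 : (1 : ℝ) ≤ m := by exact_mod_cast h1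
  refine le_csSup ⟨⌊ε⁻¹⌋₊, fun m hm => hm.2.1⟩ ⟨h1, Nat.le_floor ?_, ?_⟩
  · rw [le_inv_comm₀ (by positivity) hε, ← one_div, le_div_iff₀ (by positivity)]
    calc ε * m = ε * m * 1 := by ring
      _ ≤ ε * m * maxInvSq lam m := by gcongr
      _ ≤ 1 := h2.trans h3
  · refine le_trans ?_ (hop.one_le_maxInvSq hlam le_rfl)
    calc ε * maxInvSq lam m = ε * 1 * maxInvSq lam m := by ring
      _ ≤ ε * m * maxInvSq lam m := by gcongr
      _ ≤ 1 := h2.trans h3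

end Oracle

/-! ### Shrinkage factors -/

section Gain

variable {lam v : ℕ → ℝ} {d ε : ℝ} {j : ℕ}

theorem PriorVarianceCondition.pos (hv : PriorVarianceCondition lam v d) (hlam : ∀ j, lam j ≠ 0)
    (hε : ε ∈ Set.Ioo (0 : ℝ) 1) (hj : j < maxDim lam ε) : 0 < v j := by
  have h0 := hε.1
  have h1 := hlam j
  have h2 : 0 < ε * (lam j ^ 2)⁻¹ := by positivity
  exact lt_of_lt_of_le (mul_pos hv.1 (lt_max_of_lt_right h2)) (hv.2 ε hε j hj)

theorem gain_pos (hlam : lam j ≠ 0) (hε : 0 < ε) (hv : 0 < v j) : 0 < gain lam v ε j := by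
  unfold gain
  positivity

theorem gain_lt_one (hlam : lam j ≠ 0) (hε : 0 < ε) (hv : 0 < v j) : gain lam v ε j < 1 := by
  have : 0 < lam j ^ 2 * v j := by positivity
  rw [gain, div_lt_one (by positivity)]
  linarith

/-- The `ε Λ_j` branch of the variance condition bounds the gain away from `0`. The `√ε √Λ_j`
branch, used in `sq_one_sub_gain_le`, bounds the shrinkage bias by the noise level. -/
theorem one_le_gain_mul (hv : PriorVarianceCondition lam v d) (hlam : ∀ j, lam j ≠ 0)
    (hε : ε ∈ Set.Ioo (0 : ℝ) 1) (hj : j < maxDim lam ε) :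
    1 ≤ gain lam v ε j * (1 + 1 / d) := by
  have h0 := hε.1
  have h1 := hlam j
  have h2 := hv.pos hlam hε hj
  have hd := hv.1
  have h3 : d * (ε * (lam j ^ 2)⁻¹) ≤ v j :=
    (mul_le_mul_of_nonneg_left (le_max_right _ _) hd.le).trans (hv.2 ε hε j hj)
  have h4 : d * ε ≤ lam j ^ 2 * v j := by
    calc d * ε = lam j ^ 2 * (d * (ε * (lam j ^ 2)⁻¹)) := by field_simp
      _ ≤ _ := by gcongr
  have h5 : 1 + 1 / d = (d + 1) / d := by field_simp
  rw [gain, h5, div_mul_div_comm, one_le_div (by positivity)]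
  nlinarith

theorem sq_one_sub_gain_le (hv : PriorVarianceCondition lam v d) (hlam : ∀ j, lam j ≠ 0)
    (hε : ε ∈ Set.Ioo (0 : ℝ) 1) (hj : j < maxDim lam ε) :
    (1 - gain lam v ε j) ^ 2 ≤ ε * (lam j ^ 2)⁻¹ / d ^ 2 := by
  have h0 := hε.1
  have h1 := hlam j
  have h2 := hv.pos hlam hε hj
  have hd := hv.1
  have h3 : d * (√ε * √((lam j ^ 2)⁻¹)) ≤ v j :=
    (mul_le_mul_of_nonneg_left (le_max_left _ _) hd.le).trans (hv.2 ε hε j hj)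
  have h4 : d ^ 2 * (ε * (lam j ^ 2)⁻¹) ≤ v j ^ 2 := by
    calc d ^ 2 * (ε * (lam j ^ 2)⁻¹) = (d * (√ε * √((lam j ^ 2)⁻¹))) ^ 2 := by
          rw [mul_pow, mul_pow, Real.sq_sqrt h0.le, Real.sq_sqrt (by positivity)]
      _ ≤ _ := by gcongr
  have h5 : 1 - gain lam v ε j = ε / (lam j ^ 2 * v j + ε) := by
    rw [gain]
    field_simp
    ring
  have h6 : d ^ 2 * ε ≤ lam j ^ 2 * v j ^ 2 := by
    calc d ^ 2 * ε = lam j ^ 2 * (d ^ 2 * (ε * (lam j ^ 2)⁻¹)) := by field_simp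
      _ ≤ _ := by gcongr
  rw [h5, div_pow, div_le_div_iff₀ (by positivity) (by positivity)]
  calc ε ^ 2 * d ^ 2 = ε * (lam j ^ 2)⁻¹ * (lam j ^ 2 * (d ^ 2 * ε)) := by field_simp
    _ ≤ ε * (lam j ^ 2)⁻¹ * (lam j ^ 2 * (lam j ^ 2 * v j ^ 2)) := by gcongr
    _ = ε * (lam j ^ 2)⁻¹ * (lam j ^ 2 * v j) ^ 2 := by ring
    _ ≤ _ := by
      gcongr
      linarith

end Gain

/-! ### Chernoff bounds for Gaussian products -/

section ExponentialBounds

theorem inv_sqrt_one_add_le_exp {u : ℝ} (h0 : 0 ≤ u) (h1 : u ≤ 1) :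
    (√(1 + u))⁻¹ ≤ Real.exp (-(u / 4)) := by
  rw [Real.exp_neg]
  refine inv_anti₀ (Real.exp_pos _) (Real.le_sqrt_of_sq_le ?_)
  rw [← Real.exp_nat_mul]
  have h2 : Real.exp (u / 2) ≤ 1 / (1 - u / 2) :=
    Real.exp_bound_div_one_sub_of_interval (by linarith) (by linarith)
  have h3 : 1 / (1 - u / 2) ≤ 1 + u := by
    rw [div_le_iff₀ (by linarith)]
    nlinarith
  have h4 : ((2 : ℕ) : ℝ) * (u / 4) = u / 2 := by push_cast; ring
  rw [h4]
  exact h2.trans h3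

/-- The constant `7 / 20` is a rational just above `(log 2) / 2`. -/
theorem inv_sqrt_one_sub_le_exp {u : ℝ} (h1 : u ≤ 1 / 2) :
    (√(1 - u))⁻¹ ≤ Real.exp (7 / 20) := by
  have h2 : (Real.exp (7 / 20))⁻¹ ≤ √(1 - u) := by
    refine Real.le_sqrt_of_sq_le ?_
    rw [← Real.exp_neg, ← Real.exp_nat_mul]
    have h3 : Real.exp (-Real.log 2) = 1 / 2 := by
      rw [Real.exp_neg, Real.exp_log two_pos]
      norm_num
    have h4 : Real.exp ((2 : ℕ) * -(7 / 20)) ≤ Real.exp (-Real.log 2) := by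
      have := Real.log_two_lt_d9
      gcongr
      push_cast
      linarith
    linarith
  exact inv_le_of_inv_le₀ (Real.exp_pos _) h2

theorem lintegral_exp_sum_sq_le {m : ℕ → ℝ} {w : ℕ → ℝ≥0} (I : Finset ℕ) {c t e : ℕ → ℝ}
    (c₀ : ℝ) (hw : ∀ j ∈ I, w j ≠ 0) (ht : ∀ j ∈ I, 2 * t j * w j < 1)
    (he : ∀ j ∈ I, (√(1 - 2 * t j * w j))⁻¹ *
      Real.exp (t j * (m j - c j) ^ 2 / (1 - 2 * t j * w j)) ≤ Real.exp (e j)) :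
    ∫⁻ x, ENNReal.ofReal (Real.exp (c₀ + ∑ j ∈ I, t j * (x j - c j) ^ 2))
      ∂(Measure.infinitePi fun j => gaussianReal (m j) (w j)) ≤
      ENNReal.ofReal (Real.exp (c₀ + ∑ j ∈ I, e j)) := by
  have h1 : ∀ x : ℕ → ℝ, ENNReal.ofReal (Real.exp (c₀ + ∑ j ∈ I, t j * (x j - c j) ^ 2)) =
      ENNReal.ofReal (Real.exp c₀) *
        ∏ j ∈ I, ENNReal.ofReal (Real.exp (t j * (x j - c j) ^ 2)) := by
    intro x
    rw [Real.exp_add, Real.exp_sum, ENNReal.ofReal_mul (Real.exp_pos _).le,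
      ENNReal.ofReal_prod_of_nonneg fun _ _ => (Real.exp_pos _).le]
  simp only [h1]
  rw [lintegral_const_mul _ (by fun_prop),
    lintegral_prod_infinitePi (fun j => gaussianReal (m j) (w j)) I
      (f := fun j y => ENNReal.ofReal (Real.exp (t j * (y - c j) ^ 2))) (fun j => by fun_prop),
    Real.exp_add, Real.exp_sum, ENNReal.ofReal_mul (Real.exp_pos _).le,
    ENNReal.ofReal_prod_of_nonneg fun _ _ => (Real.exp_pos _).le]
  gcongr with j hj
  rw [lintegral_exp_sq_gaussianReal _ _ _ (hw j hj) (ht j hj)]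
  exact ENNReal.ofReal_le_ofReal (he j hj)

theorem measure_le_lintegral_of_one_le {α : Type*} [MeasurableSpace α] {ν : Measure α} {s : Set α}
    (hs : MeasurableSet s) {f : α → ℝ≥0∞} (h : ∀ᵐ x ∂ν, x ∈ s → 1 ≤ f x) :
    ν s ≤ ∫⁻ x, f x ∂ν := by
  rw [← lintegral_indicator_one hs]
  refine lintegral_mono_ae ?_
  filter_upwards [h] with x hx
  by_cases hxs : x ∈ s
  · simpa [hxs] using hx hxs
  · simp [hxs]

end ExponentialBounds

/-! ### Expected posterior probability of a dimension -/

section ModelBounds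

variable {lam θ₀ μ v : ℕ → ℝ} {C ε : ℝ}

theorem modelProb_nonneg (lam μ v : ℕ → ℝ) (C ε : ℝ) (m : ℕ) (Y : ℕ → ℝ) :
    0 ≤ modelProb lam μ v C ε m Y :=
  div_nonneg (modelWeight_pos ..).le (Finset.sum_nonneg fun _ _ => (modelWeight_pos ..).le)

theorem modelProb_le_one {m : ℕ} (hm : m ∈ Finset.Icc 1 (maxDim lam ε)) (Y : ℕ → ℝ) :
    modelProb lam μ v C ε m Y ≤ 1 :=
  div_le_one_of_le₀ (Finset.single_le_sum (fun k _ => (modelWeight_pos lam μ v C ε k Y).le) hm)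
    (Finset.sum_nonneg fun _ _ => (modelWeight_pos ..).le)

theorem modelProb_le_div {k : ℕ} (hk : k ∈ Finset.Icc 1 (maxDim lam ε)) (m : ℕ) (Y : ℕ → ℝ) :
    modelProb lam μ v C ε m Y ≤ modelWeight lam μ v C ε m Y / modelWeight lam μ v C ε k Y :=
  div_le_div_of_nonneg_left (modelWeight_pos ..).le (modelWeight_pos ..)
    (Finset.single_le_sum (fun k _ => (modelWeight_pos lam μ v C ε k Y).le) hk)

/-- The probability of `m` is at most the ratio of the weights of `m` and `k`. For `m ≤ k` this
ratio is an exponential of a negative quadratic form, so its Gaussian integral is explicit. -/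
theorem lintegral_modelProb_le_of_lt (hlam : ∀ j, lam j ≠ 0) (hε : 0 < ε)
    (hv : ∀ j < maxDim lam ε, 0 < v j) {m k : ℕ} (hk : k ∈ Finset.Icc 1 (maxDim lam ε))
    (hmk : m ≤ k) :
    ∫⁻ Y, ENNReal.ofReal (modelProb lam μ v C ε m Y) ∂(obsLaw lam ε θ₀) ≤
      ENNReal.ofReal (Real.exp (3 * C * (k - m) / 2 - ∑ j ∈ Finset.Ico m k,
        gain lam v ε j / (1 + gain lam v ε j) * (lam j ^ 2 * (θ₀ j - μ j) ^ 2) / (2 * ε))) := by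
  rw [obsLaw_eq_gaussianSeq lam hε, gaussianSeq, sub_eq_add_neg, ← Finset.sum_neg_distrib]
  have hG : ∀ j ∈ Finset.Ico m k, 0 < gain lam v ε j := fun j hj =>
    gain_pos (hlam j) hε (hv j ((Finset.mem_Ico.1 hj).2.trans_le (Finset.mem_Icc.1 hk).2))
  have hε' : ((ε.toNNReal : ℝ≥0) : ℝ) = ε := Real.coe_toNNReal _ hε.le
  have htw : ∀ j, 1 - 2 * -(gain lam v ε j / (2 * ε)) * ε = 1 + gain lam v ε j := by
    intro j
    field_simp
    ring
  refine le_trans (lintegral_mono fun Y => ENNReal.ofReal_le_ofReal ?_)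
    (lintegral_exp_sum_sq_le (c := fun j => lam j * μ j)
      (t := fun j => -(gain lam v ε j / (2 * ε))) _ _ (fun j _ => (Real.toNNReal_pos.2 hε).ne')
      (fun j hj => ?_) (fun j hj => ?_))
  · refine (modelProb_le_div hk m Y).trans (le_of_eq ?_)
    rw [modelWeight, modelWeight, ← Real.exp_sub]
    congr 1
    rw [← Finset.sum_range_add_sum_Ico _ hmk]
    simp only [neg_mul, Finset.sum_neg_distrib]
    ring
  · have := hG j hj
    rw [hε']
    linarith [htw j]
  · have hg := hG j hj
    simp only [hε', htw]
    have h1 : (√(1 + gain lam v ε j))⁻¹ ≤ 1 :=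
      inv_le_one_of_one_le₀ (Real.one_le_sqrt.2 (by linarith))
    refine (mul_le_of_le_one_left (Real.exp_pos _).le h1).trans (le_of_eq ?_)
    congr 1
    field_simp

/-- Integrating the weight ratio itself would produce factors `(1 - gain)^(-1/2)`, which are not
bounded uniformly. A probability is at most the square root of any upper bound on it, as `p² ≤ p`.
Taking that root halves the exponent: each coordinate then costs only `√2`, against a penalty
`3C/4`. -/
theorem lintegral_modelProb_le_of_gt (hlam : ∀ j, lam j ≠ 0) (hε : 0 < ε)
    (hv : ∀ j < maxDim lam ε, 0 < v j) {m k : ℕ} (hk : k ∈ Finset.Icc 1 (maxDim lam ε))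
    (hm : m ∈ Finset.Icc 1 (maxDim lam ε)) (hkm : k ≤ m) :
    ∫⁻ Y, ENNReal.ofReal (modelProb lam μ v C ε m Y) ∂(obsLaw lam ε θ₀) ≤
      ENNReal.ofReal (Real.exp (-3 * C * (m - k) / 4 + ∑ j ∈ Finset.Ico k m,
        (7 / 20 + lam j ^ 2 * (θ₀ j - μ j) ^ 2 / (2 * ε)))) := by
  rw [obsLaw_eq_gaussianSeq lam hε, gaussianSeq]
  have hε' : ((ε.toNNReal : ℝ≥0) : ℝ) = ε := Real.coe_toNNReal _ hε.le
  have htw : 2 * (1 / (4 * ε)) * ε = 1 / 2 := by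
    field_simp
    norm_num
  refine le_trans (lintegral_mono fun Y => ENNReal.ofReal_le_ofReal ?_)
    (lintegral_exp_sum_sq_le (c := fun j => lam j * μ j) (t := fun j => 1 / (4 * ε)) _ _
      (fun j _ => (Real.toNNReal_pos.2 hε).ne') (fun j hj => ?_) (fun j hj => ?_))
  · have h0 := modelProb_nonneg lam μ v C ε m Y
    have h1 := modelProb_le_one (μ := μ) (v := v) (C := C) hm Y
    have h2 := modelProb_le_div (μ := μ) (v := v) (C := C) hk m Y
    have h3 : modelProb lam μ v C ε m Y ^ 2 ≤
        modelWeight lam μ v C ε m Y / modelWeight lam μ v C ε k Y := by nlinarith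
    refine le_of_sq_le_sq (h3.trans ?_) (Real.exp_pos _).le
    rw [modelWeight, modelWeight, ← Real.exp_sub, ← Real.exp_nat_mul,
      ← Finset.sum_range_add_sum_Ico _ hkm]
    refine Real.exp_le_exp.2 ?_
    have h4 : ∑ j ∈ Finset.Ico k m, gain lam v ε j / (2 * ε) * (Y j - lam j * μ j) ^ 2 ≤
        2 * ∑ j ∈ Finset.Ico k m, 1 / (4 * ε) * (Y j - lam j * μ j) ^ 2 := by
      rw [Finset.mul_sum]
      refine Finset.sum_le_sum fun j hj => ?_
      have h5 := (gain_lt_one (hlam j) hε (hv j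
        ((Finset.mem_Ico.1 hj).2.trans_le (Finset.mem_Icc.1 hm).2))).le
      calc gain lam v ε j / (2 * ε) * (Y j - lam j * μ j) ^ 2
          ≤ 1 / (2 * ε) * (Y j - lam j * μ j) ^ 2 := by gcongr
        _ = 2 * (1 / (4 * ε) * (Y j - lam j * μ j) ^ 2) := by ring
    push_cast
    linarith
  · rw [hε', htw]
    norm_num
  · simp only [hε', htw]
    rw [Real.exp_add]
    refine mul_le_mul (inv_sqrt_one_sub_le_exp le_rfl) (le_of_eq ?_) (Real.exp_pos _).le
      (Real.exp_pos _).le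
    congr 1
    field_simp
    ring

end ModelBounds

/-! ### The sieve posterior averaged over the data -/

section Predictive

variable {lam θ₀ μ v : ℕ → ℝ} {d ε : ℝ} {m : ℕ}

/-- The law of a draw from the posterior of the sieve prior of dimension `m`, when the true
parameter is `θ₀`. -/
def predictiveLaw (lam θ₀ μ v : ℕ → ℝ) (ε : ℝ) (m : ℕ) : Measure (ℕ → ℝ) :=
  Measure.infinitePi fun j =>
    gaussianReal (μ j + if j < m then gain lam v ε j * (θ₀ j - μ j) else 0)
      (if j < m then ((gain lam v ε j ^ 2 + gain lam v ε j) * (ε * (lam j ^ 2)⁻¹)).toNNReal else 0)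

theorem lintegral_sievePosterior (hlam : ∀ j, lam j ≠ 0) (hε : 0 < ε) (hv : ∀ j < m, 0 < v j)
    {B : Set (ℕ → ℝ)} (hB : MeasurableSet B) :
    ∫⁻ Y, sievePosterior lam μ v ε m Y B ∂(obsLaw lam ε θ₀) = predictiveLaw lam θ₀ μ v ε m B := by
  rw [← Measure.bind_apply hB (Kernel.aemeasurable _), obsLaw_eq_gaussianSeq lam hε, gaussianSeq,
    sievePosterior, piKernel_comp_infinitePi, predictiveLaw]
  congr 3 with j : 1
  -- For `j < m` the variance has two parts: `gain² ε / λ_j²` from the fluctuation of the posterior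
  -- mean, and the posterior variance `gain ε / λ_j²`.
  rw [linGauss_comp_gaussianReal]
  by_cases hj : j < m
  · have hvj := hv j hj
    have hl := hlam j
    have h1 : 0 < lam j ^ 2 * v j + ε := by positivity
    have hs : sieveSlope lam v ε m j = lam j * v j / (lam j ^ 2 * v j + ε) := by
      simp [sieveSlope, sieveVar, hj, hvj.le, hε.le]
    have hg := gain_pos hl hε hvj
    simp only [hj, if_true]
    congr 1
    · rw [hs, gain]
      field_simp
      ring
    · refine NNReal.eq ?_
      simp only [NNReal.coe_add, NNReal.coe_mul, NNReal.coe_div, sieveVar, hj, if_true,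
        Real.coe_toNNReal _ (sq_nonneg _), Real.coe_toNNReal _ hvj.le, Real.coe_toNNReal _ hε.le]
      rw [Real.coe_toNNReal _ (by positivity), hs, gain]
      field_simp
  · have hs : sieveSlope lam v ε m j = 0 := by simp [sieveSlope, sieveVar, hj]
    simp [hj, hs, sieveVar]

theorem ae_predictiveLaw (lam θ₀ μ v : ℕ → ℝ) (ε : ℝ) (m : ℕ) :
    ∀ᵐ ϑ ∂(predictiveLaw lam θ₀ μ v ε m), ∀ i, ϑ (m + i) = μ (m + i) := by
  refine ae_all_iff.2 fun i => ?_
  have h := (measurePreserving_eval_infinitePi (fun j =>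
    gaussianReal (μ j + if j < m then gain lam v ε j * (θ₀ j - μ j) else 0)
      (if j < m then ((gain lam v ε j ^ 2 + gain lam v ε j) * (ε * (lam j ^ 2)⁻¹)).toNNReal
        else 0)) (m + i)).quasiMeasurePreserving
  refine h.ae (p := fun x => x = μ (m + i)) ?_
  simp

theorem measurable_sqDist (θ₀ : ℕ → ℝ) : Measurable fun ϑ => sqDist ϑ θ₀ := by
  unfold sqDist
  fun_prop

theorem ofReal_sum_le_sqDist (ϑ θ₀ : ℕ → ℝ) (k : ℕ) :
    ENNReal.ofReal (∑ j ∈ Finset.range k, (ϑ j - θ₀ j) ^ 2) ≤ sqDist ϑ θ₀ := by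
  rw [ENNReal.ofReal_sum_of_nonneg fun _ _ => sq_nonneg _]
  exact ENNReal.sum_le_tsum _

theorem sqDist_eq_of_tail (hβ : Summable fun j => (θ₀ j - μ j) ^ 2) {ϑ : ℕ → ℝ}
    (h : ∀ i, ϑ (m + i) = μ (m + i)) :
    sqDist ϑ θ₀ =
      ENNReal.ofReal (∑ j ∈ Finset.range m, (ϑ j - θ₀ j) ^ 2 + bias θ₀ μ m) := by
  have hs : Summable fun i => (θ₀ (m + i) - μ (m + i)) ^ 2 := by
    have := (summable_nat_add_iff m).2 hβ
    simpa only [add_comm] using this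
  rw [ENNReal.ofReal_add (Finset.sum_nonneg fun _ _ => sq_nonneg _) (bias_nonneg _ _ _),
    ENNReal.ofReal_sum_of_nonneg fun _ _ => sq_nonneg _, bias,
    ENNReal.ofReal_tsum_of_nonneg (fun _ => sq_nonneg _) hs, sqDist,
    ← ENNReal.summable.sum_add_tsum_nat_add' (k := m)]
  congr 1
  refine tsum_congr fun i => ?_
  rw [add_comm i m, h i, ← neg_sub, neg_sq]

theorem predictiveLaw_lt_bias_eq_zero (hβ : Summable fun j => (θ₀ j - μ j) ^ 2) {R : ℝ}
    (hR : R ≤ bias θ₀ μ m) :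
    predictiveLaw lam θ₀ μ v ε m {ϑ | sqDist ϑ θ₀ < ENNReal.ofReal R} = 0 := by
  refine measure_eq_zero_iff_ae_notMem.2 ?_
  filter_upwards [ae_predictiveLaw lam θ₀ μ v ε m] with ϑ hϑ
  rw [not_lt, sqDist_eq_of_tail hβ hϑ]
  refine ENNReal.ofReal_le_ofReal (hR.trans ?_)
  exact le_add_of_nonneg_left (Finset.sum_nonneg fun _ _ => sq_nonneg _)

/-- Chernoff bound with tilt `1 / (8V)`, `V = ε Λ_(m)`. Variances are at most `2V`, so each
coordinate costs at most `√2`. The shrinkage bias is at most `V (θ₀ j - μ j)² / d²`, so its total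
cost is bounded independently of `ε` and `m`. -/
theorem predictiveLaw_gt_le (hlam : ∀ j, lam j ≠ 0) (hβ : Summable fun j => (θ₀ j - μ j) ^ 2)
    (hv : PriorVarianceCondition lam v d) (hε : ε ∈ Set.Ioo (0 : ℝ) 1) (hm : 1 ≤ m)
    (hmG : m ≤ maxDim lam ε) (R : ℝ) :
    predictiveLaw lam θ₀ μ v ε m {ϑ | ENNReal.ofReal R < sqDist ϑ θ₀} ≤
      ENNReal.ofReal (Real.exp (7 / 20 * m + (∑' j, (θ₀ j - μ j) ^ 2) / (4 * d ^ 2) -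
        (R - bias θ₀ μ m) / (8 * (ε * maxInvSq lam m)))) := by
  have hε0 := hε.1
  have hd := hv.1
  set V := ε * maxInvSq lam m with hV
  have hVpos : 0 < V := mul_pos hε0 (maxInvSq_pos hlam hm)
  have hvar : ∀ j ∈ Finset.range m, 0 < (gain lam v ε j ^ 2 + gain lam v ε j) *
      (ε * (lam j ^ 2)⁻¹) ∧ (gain lam v ε j ^ 2 + gain lam v ε j) * (ε * (lam j ^ 2)⁻¹) ≤ 2 * V := by
    intro j hj
    have hj := Finset.mem_range.1 hj
    have hl := hlam j
    have h1 := hv.pos hlam hε (hj.trans_le hmG)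
    have h2 := gain_pos hl hε0 h1
    have h3 := gain_lt_one hl hε0 h1
    refine ⟨by positivity, mul_le_mul (by nlinarith) ?_ (by positivity) (by norm_num)⟩
    exact mul_le_mul_of_nonneg_left (invSq_le_maxInvSq lam hj) hε0.le
  have hmeas : MeasurableSet {ϑ | ENNReal.ofReal R < sqDist ϑ θ₀} :=
    measurableSet_lt measurable_const (measurable_sqDist θ₀)
  refine (measure_le_lintegral_of_one_le hmeas (f := fun ϑ => ENNReal.ofReal (Real.exp
    (-((R - bias θ₀ μ m) / (8 * V)) +
      ∑ j ∈ Finset.range m, 1 / (8 * V) * (ϑ j - θ₀ j) ^ 2))) ?_).trans ?_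
  · filter_upwards [ae_predictiveLaw lam θ₀ μ v ε m] with ϑ hϑ hlt
    replace hlt : ENNReal.ofReal R < sqDist ϑ θ₀ := hlt
    rw [sqDist_eq_of_tail hβ hϑ] at hlt
    have hlt := (ENNReal.ofReal_lt_ofReal_iff').1 hlt |>.1
    rw [ENNReal.one_le_ofReal, Real.one_le_exp_iff, ← Finset.mul_sum]
    have h1 : 0 ≤ 1 / (8 * V) * (∑ j ∈ Finset.range m, (ϑ j - θ₀ j) ^ 2 - (R - bias θ₀ μ m)) :=
      mul_nonneg (by positivity) (by linarith)
    calc 0 ≤ _ := h1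
      _ = _ := by ring
  · refine (lintegral_exp_sum_sq_le (Finset.range m)
      (e := fun j => 7 / 20 + (θ₀ j - μ j) ^ 2 / (4 * d ^ 2)) _ (fun j hj => ?_) (fun j hj => ?_)
      (fun j hj => ?_)).trans (ENNReal.ofReal_le_ofReal (Real.exp_le_exp.2 ?_))
    · rw [if_pos (Finset.mem_range.1 hj)]
      exact (Real.toNNReal_pos.2 (hvar j hj).1).ne'
    · rw [if_pos (Finset.mem_range.1 hj), Real.coe_toNNReal _ (hvar j hj).1.le]
      have := (hvar j hj).2
      calc 2 * (1 / (8 * V)) * _ ≤ 2 * (1 / (8 * V)) * (2 * V) := by gcongr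
        _ = 1 / 2 := by field_simp; norm_num
        _ < 1 := by norm_num
    · have hj' := Finset.mem_range.1 hj
      have hl := hlam j
      rw [if_pos hj', if_pos hj', Real.coe_toNNReal _ (hvar j hj).1.le]
      set τ := (gain lam v ε j ^ 2 + gain lam v ε j) * (ε * (lam j ^ 2)⁻¹)
      have hu : 2 * (1 / (8 * V)) * τ ≤ 1 / 2 := by
        have := (hvar j hj).2
        calc 2 * (1 / (8 * V)) * τ ≤ 2 * (1 / (8 * V)) * (2 * V) := by gcongr
          _ = 1 / 2 := by field_simp; norm_num
      rw [Real.exp_add]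
      refine mul_le_mul (inv_sqrt_one_sub_le_exp hu) (Real.exp_le_exp.2 ?_) (Real.exp_pos _).le
        (Real.exp_pos _).le
      have h1 : (μ j + gain lam v ε j * (θ₀ j - μ j) - θ₀ j) ^ 2 ≤
          V / d ^ 2 * (θ₀ j - μ j) ^ 2 := by
        calc (μ j + gain lam v ε j * (θ₀ j - μ j) - θ₀ j) ^ 2 =
            (1 - gain lam v ε j) ^ 2 * (θ₀ j - μ j) ^ 2 := by ring
          _ ≤ ε * (lam j ^ 2)⁻¹ / d ^ 2 * (θ₀ j - μ j) ^ 2 := by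
            gcongr
            exact sq_one_sub_gain_le hv hlam hε (hj'.trans_le hmG)
          _ ≤ _ := by
            gcongr
            exact mul_le_mul_of_nonneg_left (invSq_le_maxInvSq lam hj') hε0.le
      rw [div_le_iff₀ (by linarith)]
      calc 1 / (8 * V) * (μ j + gain lam v ε j * (θ₀ j - μ j) - θ₀ j) ^ 2
          ≤ 1 / (8 * V) * (V / d ^ 2 * (θ₀ j - μ j) ^ 2) := by gcongr
        _ = (θ₀ j - μ j) ^ 2 / (4 * d ^ 2) * (1 / 2) := by field_simp; ring
        _ ≤ _ := by
          gcongr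
          linarith
    · rw [Finset.sum_add_distrib, Finset.sum_const, Finset.card_range, nsmul_eq_mul,
        ← Finset.sum_div]
      have h1 : (∑ j ∈ Finset.range m, (θ₀ j - μ j) ^ 2) / (4 * d ^ 2) ≤
          (∑' j, (θ₀ j - μ j) ^ 2) / (4 * d ^ 2) := by
        gcongr
        exact hβ.sum_le_tsum _ fun _ _ => sq_nonneg _
      linarith

/-- Discarding coordinates only decreases the distance, so the first `k` suffice, and with them the
scale `V = ε Λ_(k)`. The tilt `-1 / (4V)` keeps `τ / (2V) ≤ 1`, as `inv_sqrt_one_add_le_exp`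
requires. The shift of the mean can only help. -/
theorem predictiveLaw_lt_le (hlam : ∀ j, lam j ≠ 0)
    (hv : PriorVarianceCondition lam v d) (hε : ε ∈ Set.Ioo (0 : ℝ) 1) {k : ℕ} (hk : 1 ≤ k)
    (hkm : k ≤ m) (hmG : m ≤ maxDim lam ε) (R : ℝ) :
    predictiveLaw lam θ₀ μ v ε m {ϑ | sqDist ϑ θ₀ < ENNReal.ofReal R} ≤
      ENNReal.ofReal (Real.exp (R / (4 * (ε * maxInvSq lam k)) -
        ε * k * meanInvSq lam k / (8 * (1 + 1 / d) * (ε * maxInvSq lam k)))) := by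
  have hε0 := hε.1
  have hd := hv.1
  set V := ε * maxInvSq lam k with hV
  have hVpos : 0 < V := mul_pos hε0 (maxInvSq_pos hlam hk)
  have hvar : ∀ j ∈ Finset.range k,
      ε * (lam j ^ 2)⁻¹ / (1 + 1 / d) ≤
        (gain lam v ε j ^ 2 + gain lam v ε j) * (ε * (lam j ^ 2)⁻¹) ∧
      (gain lam v ε j ^ 2 + gain lam v ε j) * (ε * (lam j ^ 2)⁻¹) ≤ 2 * V := by
    intro j hj
    have hj := Finset.mem_range.1 hj
    have hl := hlam j
    have hjG := hj.trans_le (hkm.trans hmG)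
    have h1 := hv.pos hlam hε hjG
    have h2 := gain_pos hl hε0 h1
    have h3 := gain_lt_one hl hε0 h1
    have h4 := one_le_gain_mul hv hlam hε hjG
    refine ⟨?_, mul_le_mul (by nlinarith) ?_ (by positivity) (by norm_num)⟩
    · rw [div_le_iff₀ (by positivity)]
      calc ε * (lam j ^ 2)⁻¹ = 1 * (ε * (lam j ^ 2)⁻¹) := by ring
        _ ≤ gain lam v ε j * (1 + 1 / d) * (ε * (lam j ^ 2)⁻¹) := by gcongr
        _ = (0 + gain lam v ε j) * (ε * (lam j ^ 2)⁻¹) * (1 + 1 / d) := by ring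
        _ ≤ _ := by
          gcongr
          positivity
    · exact mul_le_mul_of_nonneg_left (invSq_le_maxInvSq lam hj) hε0.le
  have hpos : ∀ j ∈ Finset.range k,
      0 < (gain lam v ε j ^ 2 + gain lam v ε j) * (ε * (lam j ^ 2)⁻¹) := fun j hj => by
    have hl := hlam j
    exact lt_of_lt_of_le (by positivity) (hvar j hj).1
  have hlt : ∀ j ∈ Finset.range k, j < m := fun j hj => (Finset.mem_range.1 hj).trans_le hkm
  have hmeas : MeasurableSet {ϑ | sqDist ϑ θ₀ < ENNReal.ofReal R} :=
    measurableSet_lt (measurable_sqDist θ₀) measurable_const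
  refine (measure_le_lintegral_of_one_le hmeas (f := fun ϑ => ENNReal.ofReal (Real.exp
    (R / (4 * V) + ∑ j ∈ Finset.range k, -(1 / (4 * V)) * (ϑ j - θ₀ j) ^ 2))) ?_).trans ?_
  · refine ae_of_all _ fun ϑ hϑ => ?_
    have hϑ := (ofReal_sum_le_sqDist ϑ θ₀ k).trans_lt hϑ
    have hϑ := (ENNReal.ofReal_lt_ofReal_iff').1 hϑ |>.1
    rw [ENNReal.one_le_ofReal, Real.one_le_exp_iff, ← Finset.mul_sum]
    have h1 : 0 ≤ 1 / (4 * V) * (R - ∑ j ∈ Finset.range k, (ϑ j - θ₀ j) ^ 2) :=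
      mul_nonneg (by positivity) (by linarith)
    calc 0 ≤ _ := h1
      _ = _ := by ring
  · refine (lintegral_exp_sum_sq_le (Finset.range k)
      (e := fun j => -(ε * (lam j ^ 2)⁻¹ / (8 * (1 + 1 / d) * V))) _ (fun j hj => ?_)
      (fun j hj => ?_) (fun j hj => ?_)).trans (le_of_eq ?_)
    · rw [if_pos (hlt j hj)]
      exact (Real.toNNReal_pos.2 (hpos j hj)).ne'
    · rw [if_pos (hlt j hj), Real.coe_toNNReal _ (hpos j hj).le]
      have h1 : 0 < 1 / (4 * V) * ((gain lam v ε j ^ 2 + gain lam v ε j) * (ε * (lam j ^ 2)⁻¹)) :=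
        mul_pos (by positivity) (hpos j hj)
      linarith
    · rw [if_pos (hlt j hj), if_pos (hlt j hj), Real.coe_toNNReal _ (hpos j hj).le]
      have hτ := hpos j hj
      have hτ1 := (hvar j hj).1
      have hτ2 := (hvar j hj).2
      set τ := (gain lam v ε j ^ 2 + gain lam v ε j) * (ε * (lam j ^ 2)⁻¹)
      have h1 : 1 - 2 * -(1 / (4 * V)) * τ = 1 + τ / (2 * V) := by
        field_simp
        ring
      rw [h1]
      have h2 : τ / (2 * V) ≤ 1 := (div_le_one (by positivity)).2 hτ2
      have h3 : Real.exp (-(1 / (4 * V)) *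
          (μ j + gain lam v ε j * (θ₀ j - μ j) - θ₀ j) ^ 2 / (1 + τ / (2 * V))) ≤ 1 := by
        rw [Real.exp_le_one_iff, neg_mul, neg_div]
        exact neg_nonpos.2 (by positivity)
      refine (mul_le_of_le_one_right (by positivity) h3).trans
        ((inv_sqrt_one_add_le_exp (by positivity) h2).trans (Real.exp_le_exp.2 ?_))
      rw [neg_le_neg_iff]
      calc ε * (lam j ^ 2)⁻¹ / (8 * (1 + 1 / d) * V)
          = ε * (lam j ^ 2)⁻¹ / (1 + 1 / d) / (8 * V) := by rw [div_div]; congr 1; ring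
        _ ≤ τ / (8 * V) := by gcongr
        _ = _ := by ring
    · rw [Finset.sum_neg_distrib, ← Finset.sum_div, ← Finset.mul_sum,
        ← natCast_mul_meanInvSq lam hk, ← sub_eq_add_neg, mul_assoc ε]

end Predictive

/-! ### Arithmetic of the exponents -/

section Exponents

variable {lam θ₀ μ v : ℕ → ℝ} {d C L ε r κ K : ℝ} {m k D : ℕ}

/-- The signal between `m` and `k` exceeds `(8LCq - 1) r` with `q = 1 + 1/d`, and `r ≥ ε k Λ_(k) /
L`. The quadratic term is therefore at least `2Ck - k/4`, which outweighs the penalty difference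
`3Ck/2`. -/
theorem exponent_le_of_bias_gt (hop : OperatorRegular lam C L) (hlam : ∀ j, lam j ≠ 0)
    (hβ : Summable fun j => (θ₀ j - μ j) ^ 2) (hv : PriorVarianceCondition lam v d)
    (hε : ε ∈ Set.Ioo (0 : ℝ) 1) (hk : 1 ≤ k) (hkG : k ≤ maxDim lam ε) (hmk : m ≤ k)
    (hr : ε * k * maxInvSq lam k ≤ L * r) (hb : bias θ₀ μ k ≤ r)
    (hbm : 8 * L * C * (1 + 1 / d) * r < bias θ₀ μ m) :
    3 * C * (k - m) / 2 - ∑ j ∈ Finset.Ico m k,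
        gain lam v ε j / (1 + gain lam v ε j) * (lam j ^ 2 * (θ₀ j - μ j) ^ 2) / (2 * ε) ≤
      -(k / 4) := by
  have hε0 := hε.1
  have hd := hv.1
  have hC := hop.one_le_C
  have hL := hop.one_le_L
  have hΛ := maxInvSq_pos hlam hk
  set q := 1 + 1 / d with hq
  have hq1 : 1 ≤ q := le_add_of_nonneg_right (by positivity)
  have hterm : ∀ j ∈ Finset.Ico m k, (θ₀ j - μ j) ^ 2 * (1 / (4 * q * (ε * maxInvSq lam k))) ≤
      gain lam v ε j / (1 + gain lam v ε j) * (lam j ^ 2 * (θ₀ j - μ j) ^ 2) / (2 * ε) := by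
    intro j hj
    have hjk := (Finset.mem_Ico.1 hj).2
    have hl := hlam j
    have h1 := hv.pos hlam hε (hjk.trans_le hkG)
    have h2 := gain_pos hl hε0 h1
    have h3 := gain_lt_one hl hε0 h1
    have h4 := one_le_gain_mul hv hlam hε (hjk.trans_le hkG)
    have h5 : 1 / (2 * q) ≤ gain lam v ε j / (1 + gain lam v ε j) := by
      rw [div_le_div_iff₀ (by positivity) (by positivity)]
      nlinarith
    have h6 : 1 / maxInvSq lam k ≤ lam j ^ 2 := by
      rw [one_div]
      exact inv_le_of_inv_le₀ (by positivity) (invSq_le_maxInvSq lam hjk)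
    calc (θ₀ j - μ j) ^ 2 * (1 / (4 * q * (ε * maxInvSq lam k)))
        = 1 / (2 * q) * (1 / maxInvSq lam k * (θ₀ j - μ j) ^ 2) / (2 * ε) := by
          field_simp
          norm_num
      _ ≤ _ := by gcongr
  have hsum := Finset.sum_le_sum hterm
  rw [← Finset.sum_mul] at hsum
  have hbd : (8 * L * C * q - 1) * r ≤ ∑ j ∈ Finset.Ico m k, (θ₀ j - μ j) ^ 2 := by
    have := bias_add_sum_Ico hβ hmk
    linarith
  have hLCq : 0 ≤ 8 * L * C * q - 1 := by
    have : 1 ≤ L * C * q := one_le_mul_of_one_le_of_one_le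
      (one_le_mul_of_one_le_of_one_le hL hC) hq1
    linarith
  have hkr : ε * k * maxInvSq lam k / L ≤ r := by
    rw [div_le_iff₀ (by positivity)]
    linarith
  have hmain : 2 * C * k - k / 4 ≤ (∑ j ∈ Finset.Ico m k, (θ₀ j - μ j) ^ 2) *
      (1 / (4 * q * (ε * maxInvSq lam k))) := by
    calc 2 * C * k - k / 4 ≤ 2 * C * k - k / (4 * (q * L)) := by
          gcongr
          have : 1 ≤ q * L := one_le_mul_of_one_le_of_one_le hq1 hL
          linarith
      _ = (8 * L * C * q - 1) * (ε * k * maxInvSq lam k / L) *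
          (1 / (4 * q * (ε * maxInvSq lam k))) := by
          field_simp
          ring
      _ ≤ (8 * L * C * q - 1) * r * (1 / (4 * q * (ε * maxInvSq lam k))) := by gcongr
      _ ≤ _ := by gcongr
  have hk0 : (0 : ℝ) ≤ k := k.cast_nonneg
  have hm0 : (0 : ℝ) ≤ C * m := by positivity
  have hCk : (k : ℝ) ≤ C * k := le_mul_of_one_le_left hk0 hC
  linarith

/-- With `ρ = r / (ε Λ_(k))` one has `k ≤ Lρ` and `m > 5Lρ`, hence `m - k > 4Lρ`. The signal term is
at most `Cρ/2 ≤ C(m - k)/8`, and `3/4 - 7/20 - 1/8 > 1/4`. -/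
theorem exponent_le_of_dim_gt (hop : OperatorRegular lam C L) (hlam : ∀ j, lam j ≠ 0)
    (hβ : Summable fun j => (θ₀ j - μ j) ^ 2) (hε : 0 < ε) (hk : 1 ≤ k) (hkm : k ≤ m)
    (hr : ε * k * maxInvSq lam k ≤ L * r) (hb : bias θ₀ μ k ≤ r)
    (hm : 5 * L * r < m * (ε * maxInvSq lam k)) :
    -3 * C * (m - k) / 4 + ∑ j ∈ Finset.Ico k m,
      (7 / 20 + lam j ^ 2 * (θ₀ j - μ j) ^ 2 / (2 * ε)) ≤ -k := by
  have hC := hop.one_le_C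
  have hL := hop.one_le_L
  have hΛ := maxInvSq_pos hlam hk
  have hr0 : 0 ≤ r := (bias_nonneg θ₀ μ k).trans hb
  have hterm : ∀ j ∈ Finset.Ico k m, lam j ^ 2 * (θ₀ j - μ j) ^ 2 / (2 * ε) ≤
      (θ₀ j - μ j) ^ 2 * (C / (2 * (ε * maxInvSq lam k))) := by
    intro j hj
    have h := hop.tail_le k hk (j - k)
    rw [Nat.add_sub_cancel' (Finset.mem_Ico.1 hj).1] at h
    calc lam j ^ 2 * (θ₀ j - μ j) ^ 2 / (2 * ε)
        ≤ C * (maxInvSq lam k)⁻¹ * (θ₀ j - μ j) ^ 2 / (2 * ε) := by gcongr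
      _ = _ := by field_simp
  have hsum := Finset.sum_le_sum hterm
  rw [← Finset.sum_mul] at hsum
  have hbd : ∑ j ∈ Finset.Ico k m, (θ₀ j - μ j) ^ 2 ≤ r := by
    have := bias_add_sum_Ico hβ hkm
    linarith [bias_nonneg θ₀ μ m]
  set ρ := r / (ε * maxInvSq lam k) with hρ
  have hρ0 : 0 ≤ ρ := by positivity
  have h1 : (∑ j ∈ Finset.Ico k m, (θ₀ j - μ j) ^ 2) * (C / (2 * (ε * maxInvSq lam k))) ≤
      C / 2 * ρ := by
    calc _ ≤ r * (C / (2 * (ε * maxInvSq lam k))) := by gcongr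
      _ = C / 2 * ρ := by
        rw [hρ]
        field_simp
  have h2 : 5 * (L * ρ) < m := by
    rw [← mul_assoc, hρ, mul_div_assoc', div_lt_iff₀ (by positivity)]
    exact hm
  have h3 : (k : ℝ) ≤ L * ρ := by
    rw [hρ, mul_div_assoc', le_div_iff₀ (by positivity)]
    linarith
  have h4 : ρ ≤ L * ρ := le_mul_of_one_le_left hρ0 hL
  have hn : 4 * ρ ≤ (m : ℝ) - k := by linarith
  have h5 : C * (4 * ρ) ≤ C * ((m : ℝ) - k) := by gcongr
  have h6 : (m : ℝ) - k ≤ C * ((m : ℝ) - k) := le_mul_of_one_le_left (by linarith) hC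
  rw [Finset.sum_add_distrib, Finset.sum_const, Nat.card_Ico, nsmul_eq_mul, Nat.cast_sub hkm]
  linarith

/-- `K r` dominates both `10` times the bias and, by `Λ_(m) ≤ Λ_(D) Λ_(k)`, `10 D k ε Λ_(m)`. The
Chernoff gain is thus at least `(9/8) D k`, against a cost `(7/20) m ≤ (7/20) D k`. -/
theorem exponent_le_of_sqDist_gt (hop : OperatorRegular lam C L) (hlam : ∀ j, lam j ≠ 0)
    (hε : 0 < ε) (hd : 0 < d) (hm : 1 ≤ m) (hk : 1 ≤ k) (hD : 1 ≤ D) (hmD : m ≤ D * k)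
    (hr : ε * k * maxInvSq lam k ≤ L * r) (hr0 : 0 ≤ r)
    (hbm : bias θ₀ μ m ≤ 8 * L * C * (1 + 1 / d) * r)
    (hK1 : 10 * (1 + 1 / d) * L ^ 2 * (8 * C * (1 + 1 / d)) ≤ K)
    (hK2 : 10 * (1 + 1 / d) * L ^ 2 * (D * maxInvSq lam D) ≤ K) (A : ℝ) :
    7 / 20 * m + A - (K * r - bias θ₀ μ m) / (8 * (ε * maxInvSq lam m)) ≤ A - k / 2 := by
  have hC := hop.one_le_C
  have hL := hop.one_le_L
  have hΛD := maxInvSq_pos hlam hD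
  have hΛk := maxInvSq_pos hlam hk
  have hΛm := maxInvSq_pos hlam hm
  set q := 1 + 1 / d with hq
  have hq1 : 1 ≤ q := le_add_of_nonneg_right (by positivity)
  have h1 : 10 * bias θ₀ μ m ≤ K * r := by
    calc 10 * bias θ₀ μ m ≤ 10 * (8 * L * C * q * r) := by gcongr
      _ = 10 * 1 * (L * 1) * (8 * C * q) * r := by ring
      _ ≤ 10 * q * (L * L) * (8 * C * q) * r := by gcongr
      _ = 10 * q * L ^ 2 * (8 * C * q) * r := by ring
      _ ≤ _ := by gcongr
  have hΛ : maxInvSq lam m ≤ maxInvSq lam D * maxInvSq lam k :=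
    (maxInvSq_mono lam hmD).trans (hop.submul D k hD hk)
  have h2 : 10 * (D * k) * (ε * maxInvSq lam m) ≤ K * r := by
    calc 10 * (D * k) * (ε * maxInvSq lam m)
        ≤ 10 * (D * k) * (ε * (maxInvSq lam D * maxInvSq lam k)) := by gcongr
      _ = 10 * (D * maxInvSq lam D) * (ε * k * maxInvSq lam k) := by ring
      _ ≤ 10 * (D * maxInvSq lam D) * (L * r) := by gcongr
      _ = 10 * 1 * (L * 1) * (D * maxInvSq lam D) * r := by ring
      _ ≤ 10 * q * (L * L) * (D * maxInvSq lam D) * r := by gcongr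
      _ = 10 * q * L ^ 2 * (D * maxInvSq lam D) * r := by ring
      _ ≤ _ := by gcongr
  have h3 : 9 / 8 * ((D : ℝ) * k) ≤ (K * r - bias θ₀ μ m) / (8 * (ε * maxInvSq lam m)) := by
    rw [le_div_iff₀ (by positivity)]
    linarith
  have h4 : (m : ℝ) ≤ D * k := by exact_mod_cast hmD
  have h5 : (k : ℝ) ≤ D * k := le_mul_of_one_le_left (by positivity) (by exact_mod_cast hD)
  linarith

theorem exponent_le_of_sqDist_lt (hop : OperatorRegular lam C L) (hlam : ∀ j, lam j ≠ 0)
    (hε : 0 < ε) (hd : 0 < d) (hk : 1 ≤ k) (hκ : 0 < κ)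
    (hr : κ * r ≤ ε * k * meanInvSq lam k) (hK : 50 * (1 + 1 / d) ≤ K * κ) :
    K⁻¹ * r / (4 * (ε * maxInvSq lam k)) -
        ε * k * meanInvSq lam k / (8 * (1 + 1 / d) * (ε * maxInvSq lam k)) ≤
      -(k / (10 * (1 + 1 / d) * L)) := by
  have hL := hop.one_le_L
  have hΛ := maxInvSq_pos hlam hk
  have hM := meanInvSq_pos hlam hk
  set q := 1 + 1 / d with hq
  have hq1 : 1 ≤ q := le_add_of_nonneg_right (by positivity)
  have hK0 : 0 < K := pos_of_mul_pos_left (by linarith : 0 < K * κ) hκ.le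
  set E := ε * k * meanInvSq lam k with hE
  have hE0 : 0 < E := by positivity
  have h1 : K⁻¹ * r ≤ E / (50 * q) := by
    rw [inv_mul_le_iff₀ hK0, mul_div_assoc', le_div_iff₀ (by positivity)]
    refine le_of_mul_le_mul_right ?_ hκ
    calc r * (50 * q) * κ = κ * r * (50 * q) := by ring
      _ ≤ E * (K * κ) := by gcongr
      _ = K * E * κ := by ring
  have h2 : k / L ≤ E / (ε * maxInvSq lam k) := by
    rw [div_le_div_iff₀ (by positivity) (by positivity)]
    calc k * (ε * maxInvSq lam k) = ε * k * maxInvSq lam k := by ring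
      _ ≤ ε * k * (L * meanInvSq lam k) := by
        gcongr
        exact hop.maxInvSq_le hlam hk
      _ = E * L := by rw [hE]; ring
  calc K⁻¹ * r / (4 * (ε * maxInvSq lam k)) - E / (8 * q * (ε * maxInvSq lam k))
      ≤ E / (50 * q) / (4 * (ε * maxInvSq lam k)) - E / (8 * q * (ε * maxInvSq lam k)) := by
        gcongr
    -- `1/200 - 1/8 = -24/200`.
    _ = -(24 / 200 / q * (E / (ε * maxInvSq lam k))) := by
        field_simp
        ring
    _ ≤ -(20 / 200 / q * (k / L)) := by
        gcongr
        norm_num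
    _ = _ := by
        field_simp
        norm_num

end Exponents

/-! ### Uniform bound over the dimensions -/

section Concentration

variable {lam θ₀ μ v : ℕ → ℝ} {d C L ε ε₀ : ℝ}

theorem le_oracleD_mul (hop : OperatorRegular lam C L) (hlam : ∀ j, lam j ≠ 0)
    (hκ : 0 < oracleKappa lam θ₀ μ ε₀) (hε : ε ∈ Set.Ioo 0 ε₀) {m : ℕ}
    (hm : m * (ε * maxInvSq lam (oracleDim lam θ₀ μ ε)) ≤ 5 * L * oracleRate lam θ₀ μ ε) :
    m ≤ oracleD lam θ₀ μ L ε₀ * oracleDim lam θ₀ μ ε := by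
  have hk := (oracleDim_mem (θ₀ := θ₀) (μ := μ) hop hlam hε.1).1
  have h1 := (oracleKappa_mul_le (θ₀ := θ₀) (μ := μ) hop hlam hε).trans (min_le_right _ _)
  have h2 := hop.meanInvSq_le hlam hk
  have hΛ := maxInvSq_pos hlam hk
  have hε0 := hε.1
  have hL := hop.one_le_L
  set k := oracleDim lam θ₀ μ ε
  set κ := oracleKappa lam θ₀ μ ε₀
  set r := oracleRate lam θ₀ μ ε
  have h3 : (m : ℝ) ≤ 5 * L / κ * k := by
    refine le_of_mul_le_mul_right ?_ (mul_pos hε0 hΛ)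
    calc m * (ε * maxInvSq lam k) ≤ 5 * L * r := hm
      _ = 5 * L / κ * (κ * r) := by field_simp
      _ ≤ 5 * L / κ * (ε * k * maxInvSq lam k) := by
        exact mul_le_mul_of_nonneg_left (h1.trans (by gcongr)) (by positivity)
      _ = 5 * L / κ * k * (ε * maxInvSq lam k) := by ring
  have h4 : (m : ℝ) ≤ (oracleD lam θ₀ μ L ε₀ : ℝ) * k := by
    refine h3.trans ?_
    gcongr
    exact Nat.le_ceil _
  exact_mod_cast h4

theorem lintegral_modelProb_mul_le (hlam : ∀ j, lam j ≠ 0)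
    (hβ : Summable fun j => (θ₀ j - μ j) ^ 2) (hε₀' : ε₀ ≤ 1)
    (hv : PriorVarianceCondition lam v d) (hop : OperatorRegular lam C L)
    (hκ : 0 < oracleKappa lam θ₀ μ ε₀) (hε : ε ∈ Set.Ioo 0 ε₀)
    (hkG : oracleDim lam θ₀ μ ε ≤ maxDim lam ε) {m : ℕ}
    (hm : m ∈ Finset.Icc 1 (maxDim lam ε)) :
    ∫⁻ Y, ENNReal.ofReal (modelProb lam μ v C ε m Y) * sievePosterior lam μ v ε m Y
        {ϑ | ENNReal.ofReal ((oracleConst lam θ₀ μ d C L ε₀)⁻¹ * oracleRate lam θ₀ μ ε) ≤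
            sqDist ϑ θ₀ ∧ sqDist ϑ θ₀ ≤
            ENNReal.ofReal (oracleConst lam θ₀ μ d C L ε₀ * oracleRate lam θ₀ μ ε)}ᶜ
        ∂(obsLaw lam ε θ₀) ≤
      2 * ENNReal.ofReal (Real.exp ((∑' j, (θ₀ j - μ j) ^ 2) / (4 * d ^ 2) -
        oracleDim lam θ₀ μ ε / (10 * (1 + 1 / d) * L))) := by
  have hε1 : ε ∈ Set.Ioo (0 : ℝ) 1 := ⟨hε.1, hε.2.trans_le hε₀'⟩
  have hε0 := hε.1
  have hd := hv.1
  have hC := hop.one_le_C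
  have hL := hop.one_le_L
  obtain ⟨hm1, hmG⟩ := Finset.mem_Icc.1 hm
  have hvpos : ∀ j < maxDim lam ε, 0 < v j := fun j hj => hv.pos hlam hε1 hj
  have hk := (oracleDim_mem (θ₀ := θ₀) (μ := μ) hop hlam hε0).1
  have hr : ε * oracleDim lam θ₀ μ ε * maxInvSq lam (oracleDim lam θ₀ μ ε) ≤
      L * oracleRate lam θ₀ μ ε := hop.mul_maxInvSq_le_rate hlam hε0 hk
  have hr0 : 0 < oracleRate lam θ₀ μ ε := oracleRate_pos hop hlam hε0
  have hb : bias θ₀ μ (oracleDim lam θ₀ μ ε) ≤ oracleRate lam θ₀ μ ε := le_max_left _ _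
  have hκr := oracleKappa_mul_le (θ₀ := θ₀) (μ := μ) hop hlam hε
  have hκ1 := oracleKappa_le_one (θ₀ := θ₀) (μ := μ) hop hlam (hε0.trans hε.2)
  have hDle : 5 * L / oracleKappa lam θ₀ μ ε₀ ≤ oracleD lam θ₀ μ L ε₀ := Nat.le_ceil _
  have hmD := fun h => le_oracleD_mul hop hlam hκ hε (m := m) h
  have hK1 : 10 * (1 + 1 / d) * L ^ 2 * (8 * C * (1 + 1 / d)) ≤
      oracleConst lam θ₀ μ d C L ε₀ := by
    unfold oracleConst
    gcongr
    exacts [le_max_left _ _, le_max_left _ _]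
  have hK2 : 10 * (1 + 1 / d) * L ^ 2 *
      (oracleD lam θ₀ μ L ε₀ * maxInvSq lam (oracleD lam θ₀ μ L ε₀)) ≤
      oracleConst lam θ₀ μ d C L ε₀ := by
    have : 0 ≤ maxInvSq lam (oracleD lam θ₀ μ L ε₀) := Real.iSup_nonneg fun j => by positivity
    unfold oracleConst
    gcongr
    exacts [le_max_left _ _, le_max_right _ _]
  set k := oracleDim lam θ₀ μ ε with hkdef
  set r := oracleRate lam θ₀ μ ε with hrdef
  set κ := oracleKappa lam θ₀ μ ε₀ with hκdef
  set K := oracleConst lam θ₀ μ d C L ε₀ with hKdef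
  set D := oracleD lam θ₀ μ L ε₀ with hDdef
  set q := 1 + 1 / d with hq
  set S := ∑' j, (θ₀ j - μ j) ^ 2 with hS
  have hS0 : 0 ≤ S := tsum_nonneg fun _ => sq_nonneg _
  have hq1 : 1 ≤ q := le_add_of_nonneg_right (by positivity)
  have hD1 : 1 ≤ D := by
    have : (0 : ℝ) < D := lt_of_lt_of_le (by positivity) hDle
    exact_mod_cast this
  -- The `50` is the `10` in `K°` times the `5` in `D° ≥ 5L/κ°`.
  have hKκ : 50 * q ≤ K * κ := by
    have hΛD := hop.one_le_maxInvSq hlam hD1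
    calc 50 * q = 10 * q * (1 * 1) * (5 * 1 / κ * 1) * κ := by
          field_simp
          norm_num
      _ ≤ 10 * q * (L * L) * (5 * L / κ * maxInvSq lam D) * κ := by gcongr
      _ ≤ 10 * q * (L * L) * (D * maxInvSq lam D) * κ := by gcongr
      _ = 10 * q * L ^ 2 * (D * maxInvSq lam D) * κ := by ring
      _ ≤ _ := by gcongr
  have hK0 : 0 < K := pos_of_mul_pos_left (by linarith : 0 < K * κ) hκ.le
  have hck : (k : ℝ) / (10 * q * L) ≤ k / 4 := by
    have : 1 ≤ q * L := one_le_mul_of_one_le_of_one_le hq1 hL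
    gcongr
    linarith
  have hk0 : (0 : ℝ) ≤ k := k.cast_nonneg
  have hA0 : 0 ≤ S / (4 * d ^ 2) := by positivity
  set T := ENNReal.ofReal (Real.exp (S / (4 * d ^ 2) - k / (10 * q * L))) with hT
  have hexp : ∀ x, x ≤ S / (4 * d ^ 2) - k / (10 * q * L) →
      ENNReal.ofReal (Real.exp x) ≤ T := fun x hx =>
    ENNReal.ofReal_le_ofReal (Real.exp_le_exp.2 hx)
  have hT2 : T ≤ 2 * T := by
    rw [two_mul]
    exact le_self_add
  have hB : ∀ B : Set (ℕ → ℝ), ∫⁻ Y, ENNReal.ofReal (modelProb lam μ v C ε m Y) *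
      sievePosterior lam μ v ε m Y B ∂(obsLaw lam ε θ₀) ≤
      ∫⁻ Y, ENNReal.ofReal (modelProb lam μ v C ε m Y) ∂(obsLaw lam ε θ₀) := fun B =>
    lintegral_mono fun Y => mul_le_of_le_one_right zero_le prob_le_one
  by_cases hlow : m < k ∧ 8 * L * C * q * r < bias θ₀ μ m
  · refine (hB _).trans ((lintegral_modelProb_le_of_lt hlam hε0 hvpos
      (Finset.mem_Icc.2 ⟨hk, hkG⟩) hlow.1.le).trans ((hexp _ ?_).trans hT2))
    have := exponent_le_of_bias_gt hop hlam hβ hv hε1 hk hkG hlow.1.le hr hb hlow.2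
    linarith
  by_cases hhigh : k < m ∧ 5 * L * r < m * (ε * maxInvSq lam k)
  · refine (hB _).trans ((lintegral_modelProb_le_of_gt hlam hε0 hvpos
      (Finset.mem_Icc.2 ⟨hk, hkG⟩) hm hhigh.1.le).trans ((hexp _ ?_).trans hT2))
    have := exponent_le_of_dim_gt hop hlam hβ hε0 hk hhigh.1.le hr hb hhigh.2
    linarith
  have hbm : bias θ₀ μ m ≤ 8 * L * C * q * r := by
    rcases lt_or_ge m k with h | h
    · exact not_lt.1 fun h' => hlow ⟨h, h'⟩
    · refine (bias_antitone hβ h).trans (hb.trans (le_mul_of_one_le_left hr0.le ?_))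
      have : 1 ≤ L * C * q := one_le_mul_of_one_le_of_one_le
        (one_le_mul_of_one_le_of_one_le hL hC) hq1
      linarith
  have hmDk : m ≤ D * k := by
    rcases le_or_gt m k with h | h
    · exact h.trans (Nat.le_mul_of_pos_left k hD1)
    · exact hmD (not_lt.1 fun h' => hhigh ⟨h, h'⟩)
  have hms := measurable_sqDist θ₀
  set Blow : Set (ℕ → ℝ) := {ϑ | sqDist ϑ θ₀ < ENNReal.ofReal (K⁻¹ * r)} with hBlow
  set Bhigh : Set (ℕ → ℝ) := {ϑ | ENNReal.ofReal (K * r) < sqDist ϑ θ₀} with hBhigh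
  have hBlowm : MeasurableSet Blow := measurableSet_lt hms measurable_const
  have hBhighm : MeasurableSet Bhigh := measurableSet_lt measurable_const hms
  have hsub : {ϑ | ENNReal.ofReal (K⁻¹ * r) ≤ sqDist ϑ θ₀ ∧
      sqDist ϑ θ₀ ≤ ENNReal.ofReal (K * r)}ᶜ ⊆ Blow ∪ Bhigh := by
    intro ϑ hϑ
    by_contra hcon
    refine hϑ ⟨not_lt.1 fun h => hcon (Or.inl h), not_lt.1 fun h => hcon (Or.inr h)⟩
  have hup : predictiveLaw lam θ₀ μ v ε m Bhigh ≤ T := by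
    refine (predictiveLaw_gt_le hlam hβ hv hε1 hm1 hmG (K * r)).trans (hexp _ ?_)
    have := exponent_le_of_sqDist_gt hop hlam hε0 hd hm1 hk hD1 hmDk hr hr0.le hbm hK1 hK2
      (S / (4 * d ^ 2))
    linarith
  have hdown : predictiveLaw lam θ₀ μ v ε m Blow ≤ T := by
    -- For `m < k` the squared distance is almost surely at least the bias at `m`, hence at least
    -- that at `k`, which is at least `κ r ≥ r / K`. Only `m ≥ k` needs the Chernoff bound.
    rcases lt_or_ge m k with h | h
    · rw [predictiveLaw_lt_bias_eq_zero hβ]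
      · exact zero_le
      · refine le_trans ?_ ((hκr.trans (min_le_left _ _)).trans (bias_antitone hβ h.le))
        gcongr
        rw [inv_le_iff_one_le_mul₀ hK0]
        linarith
    · refine (predictiveLaw_lt_le hlam hv hε1 hk h hmG (K⁻¹ * r)).trans (hexp _ ?_)
      have := exponent_le_of_sqDist_lt hop hlam hε0 hd hk hκ (hκr.trans (min_le_right _ _)) hKκ
      linarith
  calc ∫⁻ Y, ENNReal.ofReal (modelProb lam μ v C ε m Y) * sievePosterior lam μ v ε m Y
        {ϑ | ENNReal.ofReal (K⁻¹ * r) ≤ sqDist ϑ θ₀ ∧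
          sqDist ϑ θ₀ ≤ ENNReal.ofReal (K * r)}ᶜ ∂(obsLaw lam ε θ₀)
      ≤ ∫⁻ Y, (sievePosterior lam μ v ε m Y Blow + sievePosterior lam μ v ε m Y Bhigh)
          ∂(obsLaw lam ε θ₀) := by
        refine lintegral_mono fun Y => ?_
        refine (mul_le_of_le_one_left zero_le ?_).trans
          ((measure_mono hsub).trans (measure_union_le _ _))
        exact ENNReal.ofReal_le_one.2 (modelProb_le_one hm Y)
    _ = predictiveLaw lam θ₀ μ v ε m Blow + predictiveLaw lam θ₀ μ v ε m Bhigh := by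
        have hvm : ∀ j < m, 0 < v j := fun j hj => hvpos j (hj.trans_le hmG)
        rw [lintegral_add_left (Kernel.measurable_coe _ hBlowm),
          lintegral_sievePosterior hlam hε0 hvm hBlowm,
          lintegral_sievePosterior hlam hε0 hvm hBhighm]
    _ ≤ 2 * T := by
        rw [two_mul]
        gcongr

/-- Eventually `g ≤ (c/2) k`, so half of the linear decay survives. With `g = log G_ε` this pays for
the sum over the dimensions. -/
theorem tendsto_log_sub_atBot {g k : ℝ → ℝ} {l : Filter ℝ} {a c : ℝ} (hc : 0 < c)
    (hk : Tendsto k l atTop) (hg : Tendsto (fun x => g x / k x) l (𝓝 0)) :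
    Tendsto (fun x => g x + (a - c * k x)) l atBot := by
  have h1 : Tendsto (fun x => a - c / 2 * k x) l atBot := by
    have h := (tendsto_const_mul_atTop_of_pos (half_pos hc)).2 hk
    simpa only [sub_eq_add_neg, Function.comp_def] using
      tendsto_atBot_add_const_left l a (tendsto_neg_atTop_atBot.comp h)
  refine tendsto_atBot_mono' l ?_ h1
  filter_upwards [hk.eventually_gt_atTop 0, hg.eventually_lt_const (half_pos hc)] with x hx hgx
  rw [div_lt_iff₀ hx] at hgx
  linarith

end Concentration

end SieveGSSM

end

theorem mainTheorem1 (lam θ₀ μ v : ℕ → ℝ) (d C L ε₀ : ℝ)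
    (hlam : ∀ j, lam j ≠ 0)
    (hθ₀ : Summable fun j => θ₀ j ^ 2) (hμ : Summable fun j => μ j ^ 2)
    (hε₀ : 0 < ε₀) (hε₀' : ε₀ ≤ 1)
    (hv : SieveGSSM.PriorVarianceCondition lam v d)
    (hop : SieveGSSM.OperatorRegular lam C L)
    (hκ : 0 < SieveGSSM.oracleKappa lam θ₀ μ ε₀)
    (hG : Tendsto (fun ε : ℝ => Real.log (SieveGSSM.maxDim lam ε : ℝ) /
      (SieveGSSM.oracleDim lam θ₀ μ ε : ℝ)) (𝓝[>] 0) (𝓝 0)) :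
    Tendsto
      (fun ε : ℝ => ∫⁻ Y, SieveGSSM.hierPosterior lam μ v C ε Y
        {ϑ | ENNReal.ofReal ((SieveGSSM.oracleConst lam θ₀ μ d C L ε₀)⁻¹ *
                SieveGSSM.oracleRate lam θ₀ μ ε) ≤ SieveGSSM.sqDist ϑ θ₀ ∧
              SieveGSSM.sqDist ϑ θ₀ ≤
                ENNReal.ofReal (SieveGSSM.oracleConst lam θ₀ μ d C L ε₀ *
                  SieveGSSM.oracleRate lam θ₀ μ ε)}
        ∂(SieveGSSM.obsLaw lam ε θ₀))
      (𝓝[>] 0) (𝓝 1) := by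
  have hβ := SieveGSSM.summable_sq_sub hθ₀ hμ
  have hd := hv.1
  have hL := hop.one_le_L
  set A : ℝ := (∑' j, (θ₀ j - μ j) ^ 2) / (4 * d ^ 2)
  have hc : 0 < 1 / (10 * (1 + 1 / d) * L) := by positivity
  have hdim := SieveGSSM.tendsto_oracleDim hop hlam hε₀ hκ
  have hbound : Tendsto (fun ε : ℝ => 2 * ENNReal.ofReal (Real.exp
      (Real.log (SieveGSSM.maxDim lam ε) + (A - 1 / (10 * (1 + 1 / d) * L) *
        SieveGSSM.oracleDim lam θ₀ μ ε)))) (𝓝[>] 0) (𝓝 0) := by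
    have h1 := Real.tendsto_exp_atBot.comp (SieveGSSM.tendsto_log_sub_atBot (a := A) hc
      (tendsto_natCast_atTop_atTop.comp hdim) hG)
    have h2 := ENNReal.Tendsto.const_mul (a := 2) (ENNReal.tendsto_ofReal h1)
      (Or.inr ENNReal.ofNat_ne_top)
    simpa using h2
  have hlower := ENNReal.Tendsto.sub (tendsto_const_nhds (x := (1 : ENNReal))) hbound
    (Or.inl ENNReal.one_ne_top)
  rw [tsub_zero] at hlower
  refine tendsto_of_tendsto_of_tendsto_of_le_of_le' hlower tendsto_const_nhds ?_ ?_
  · filter_upwards [Ioo_mem_nhdsGT hε₀,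
      SieveGSSM.eventually_oracleDim_le_maxDim (θ₀ := θ₀) (μ := μ) hop hlam] with ε hε hkG
    have hε1 : ε ≤ 1 := hε.2.le.trans hε₀'
    have hvpos : ∀ j < SieveGSSM.maxDim lam ε, 0 < v j := fun j hj =>
      hv.pos hlam ⟨hε.1, hε.2.trans_le hε₀'⟩ hj
    set S : Set (ℕ → ℝ) := {ϑ | ENNReal.ofReal ((SieveGSSM.oracleConst lam θ₀ μ d C L ε₀)⁻¹ *
          SieveGSSM.oracleRate lam θ₀ μ ε) ≤ SieveGSSM.sqDist ϑ θ₀ ∧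
        SieveGSSM.sqDist ϑ θ₀ ≤ ENNReal.ofReal (SieveGSSM.oracleConst lam θ₀ μ d C L ε₀ *
          SieveGSSM.oracleRate lam θ₀ μ ε)} with hSdef
    have hms := SieveGSSM.measurable_sqDist θ₀
    have hS : MeasurableSet S :=
      (measurableSet_le measurable_const hms).inter (measurableSet_le hms measurable_const)
    -- The tail condition makes `lam` bounded, so the means of the data differ by a square summable
    -- sequence, as the Cameron–Martin step requires.
    have hsum : Summable fun j => (lam j * θ₀ j - lam j * μ j) ^ 2 := by
      refine Summable.of_nonneg_of_le (fun j => sq_nonneg _) (fun j => ?_)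
        (hβ.mul_left (max (lam 0 ^ 2) C))
      rw [← mul_sub, mul_pow]
      exact mul_le_mul_of_nonneg_right (hop.sq_le hlam j) (sq_nonneg _)
    have hcompl : ∫⁻ Y, SieveGSSM.hierPosterior lam μ v C ε Y Sᶜ ∂(SieveGSSM.obsLaw lam ε θ₀) ≤
        2 * ENNReal.ofReal (Real.exp (Real.log (SieveGSSM.maxDim lam ε) +
          (A - 1 / (10 * (1 + 1 / d) * L) * SieveGSSM.oracleDim lam θ₀ μ ε))) := by
      have hGpos : (0 : ℝ) < SieveGSSM.maxDim lam ε := by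
        exact_mod_cast SieveGSSM.one_le_maxDim lam hε.1 hε1
      rw [SieveGSSM.lintegral_hierPosterior hε.1 hε1 hvpos hsum hS.compl]
      refine (Finset.sum_le_card_nsmul _ _ _ fun m hm =>
        SieveGSSM.lintegral_modelProb_mul_le hlam hβ hε₀' hv hop hκ hε hkG hm).trans (le_of_eq ?_)
      rw [Nat.card_Icc, Nat.add_sub_cancel, nsmul_eq_mul, Real.exp_add, Real.exp_log hGpos,
        ENNReal.ofReal_mul hGpos.le, ENNReal.ofReal_natCast, one_div_mul_eq_div, mul_left_comm]
    have hone : ∫⁻ Y, SieveGSSM.hierPosterior lam μ v C ε Y S ∂(SieveGSSM.obsLaw lam ε θ₀) +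
        ∫⁻ Y, SieveGSSM.hierPosterior lam μ v C ε Y Sᶜ ∂(SieveGSSM.obsLaw lam ε θ₀) = 1 := by
      rw [← lintegral_add_left (Kernel.measurable_coe _ hS)]
      simp only [measure_add_measure_compl hS, measure_univ, lintegral_one]
    refine tsub_le_iff_right.2 ?_
    rw [← hone]
    gcongr
  · refine Eventually.of_forall fun ε => ?_
    refine (lintegral_mono fun Y => prob_le_one).trans (le_of_eq ?_)
    rw [lintegral_one, measure_univ]
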